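/- Theorem 3. For a stream $D=(p_1,\dots,p_m)$ of elements of $\{1,\dots,n\}$ let $f_i=|\{j: p_j=i\}|$ be the frequency of $i$, and, for an integer $k\ge 3$, call $i\in\{1,\dots,n\}$ heavy if $f_i^k>100\sum_{j\ne i}f_j^k$. A (randomized, one-pass) streaming algorithm is given $n$, but not $m$, keeps a bit string as its memory, and reads the elements of the stream once, one after the other; at each element it rewrites its memory as a computable function of $n$, the old memory, the current element and a fresh random number that is uniform on a finite range of computable size; at the end of the stream its output is a computable function of $n$ and its memory. Its space on a stream is the largest number of bits that its memory holds between two elements, in the worst case over the random choices. Let $k\ge 3$ and $a\ge 0$ be integers and let $\varepsilon>0$. There are a one-pass streaming algorithm and a constant $C>0$, both depending only on $k$, $\varepsilon$ and $a$, such that the following holds for all $n\ge 2$ and all streams $D$ of elements of $\{1,\dots,n\}$ of length $m\le n^a$. 1. The algorithm uses at most $C\,n^{1-2/k}\log n$ bits. 2. With probability $1$, it outputs a pair $(i,\tilde f_i)$ with $i\in\{1,\dots,n\}$, $\tilde f_i$ a non-negative integer, and $\tilde f_i\le f_i$. 3. If $i$ is a heavy element of $D$, then with probability at least $2/3$ the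 algorithm outputs this element $i$ together with some $\tilde f_i$ such that $\tilde f_i\ge(1-\varepsilon)f_i$. -/

import Mathlib

/-- The frequency `f_i` of the element `i` in the stream `D`. -/
def frequency (D : List ℕ) (i : ℕ) : ℕ := D.count i

/-- `D` is a stream of elements of `{1, …, n}`. -/
def IsStream (n : ℕ) (D : List ℕ) : Prop := ∀ p ∈ D, p ∈ Finset.Icc 1 n

/-- `i ∈ {1, …, n}` is heavy in `D`: `f_i ^ k > 100 * ∑_{j ≠ i} f_j ^ k`. -/
def IsHeavy (k n : ℕ) (D : List ℕ) (i : ℕ) : Prop :=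
  i ∈ Finset.Icc 1 n ∧
    100 * ∑ j ∈ (Finset.Icc 1 n).erase i, frequency D j ^ k < frequency D i ^ k

/-- A randomized one-pass streaming algorithm, uniform in the universe size `n`.
Its memory is a bit string. When an element `x` of the stream arrives, the algorithm draws a
fresh random number, uniform on a finite range `{0, …, N}` of its choice, and rewrites its memory
as a function of `n`, the old memory, `x` and the random number; it keeps nothing else: neither
the stream, nor its length, nor earlier random numbers can be consulted again. At the end
of the stream (which is not announced) the answer is read off the memory.
All the maps are computable. -/
structure StreamingAlgorithm where
  /-- the initial memory, from `n` -/
  init : ℕ → List Bool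
  /-- the upper end `N` of the range of the random number, from `n`, the memory and the element -/
  range : ℕ × List Bool × ℕ → ℕ
  /-- the new memory, from `n`, the old memory, the element, and the random number -/
  update : (ℕ × List Bool × ℕ) × ℕ → List Bool
  /-- the answer, a pair `(i, f̃_i)`, from `n` and the memory -/
  output : ℕ × List Bool → ℕ × ℕ
  computable_init : Computable init
  computable_range : Computable range
  computable_update : Computable update
  computable_output : Computable output

namespace StreamingAlgorithm

/-- The law of the memory after the arrival of `x`, when it was `w` before. -/
noncomputable def step (A : StreamingAlgorithm) (n : ℕ) (w : List Bool) (x : ℕ) :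
    PMF (List Bool) :=
  (PMF.uniformOfFintype (Fin (A.range (n, w, x) + 1))).map
    fun u => A.update ((n, w, x), (u : ℕ))

/-- The law of the memory after one pass over the stream `D`. -/
noncomputable def run (A : StreamingAlgorithm) (n : ℕ) (D : List ℕ) : PMF (List Bool) :=
  D.foldl (fun μ x => μ.bind fun w => A.step n w x) (PMF.pure (A.init n))

/-- The law of the answer after one pass over the stream `D`. -/
noncomputable def answer (A : StreamingAlgorithm) (n : ℕ) (D : List ℕ) : PMF (ℕ × ℕ) :=
  (A.run n D).map fun w => A.output (n, w)

/-- On the stream `D`, for all outcomes of the random numbers, the memory never holds more than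
`s` bits, at any time of the pass. -/
def UsesAtMostBits (A : StreamingAlgorithm) (n : ℕ) (D : List ℕ) (s : ℝ) : Prop :=
  ∀ D' : List ℕ, D' <+: D → ∀ w ∈ (A.run n D').support, (w.length : ℝ) ≤ s

end StreamingAlgorithm

/-!
A heavy element `i` is caught by counters of its arrivals. At level `h` each arrival gives birth to
a counter with probability `64⁻¹ ^ h`; this level is responsible for `f_i` of order `64 ^ h`.
Let `N` be the smaller of `64 ^ h` and `n ^ (1 / k)`, up to constants. At most `N ^ k` elements
occur, so interpolation between the exponents `0` and `k` bounds `∑_{j ≠ i} f_j ^ q` by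
`O(N ^ (k - q) * f_i ^ q)`; the case `q = 1` bounds the length of the stream.

Level `h` cuts time into slots of equal length and groups the slots into rows. Slot `y` has room for
`O(N ^ (k - 5 / 2) * 2 ^ log_8 y)` counters, at most `O(N ^ (k - 2))`. From one level to the next
the slots become at least 64 times longer, so the capacities of the levels at a given time form a
geometric series with sum `O(n ^ (1 - 2 / k))`, and a counter takes `O(log n)` bits.

Old counters compete by the count minus the tolls due since birth. By the rising sun lemma most
arrivals of `i` are good: from then on `i` keeps arriving at twice the rate of the tolls. If an
arrival of `j` still beats a good arrival of `i` in row `l`, then `f_j` is at least the toll between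
its own row and `l`, and `2 * f_j` is at least the number of arrivals of `i` since the good one.
So the number of such pairs, weighted by the toll of the row, is at most `2 * ∑_{j ≠ i} f_j ^ 3`,
which the case `q = 3` controls. As the product of the capacity and the toll is the same in all
rows, Markov's inequality bounds the probability that a good arrival is displaced in any of them.
The young rivals, those born in the same row, are few because the row is short compared with its
capacity.
-/

open MeasureTheory
open scoped Finset

/-! ### Codes and counting -/

theorem primrec_nat_pow : Primrec₂ ((· ^ ·) : ℕ → ℕ → ℕ) :=
  Primrec₂.unpaired'.1 Nat.Primrec.pow

theorem primrec_nat_log (b : ℕ) : Primrec (Nat.log b) := by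
  rcases Nat.lt_or_ge 1 b with hb | hb
  · have hgreatest : Primrec fun n => Nat.findGreatest (fun i => b ^ i ≤ n) n :=
      Primrec.nat_findGreatest Primrec.id
        (Primrec.nat_le.comp (primrec_nat_pow.comp (Primrec.const b) Primrec.snd) Primrec.fst)
    refine hgreatest.of_eq fun n => ?_
    rcases Nat.eq_zero_or_pos n with rfl | hn
    · simp
    · rw [Nat.findGreatest_eq_iff]
      exact ⟨Nat.log_le_self b n, fun _ => Nat.pow_log_le_self b hn.ne',
        fun i hi _ => not_le.2 (Nat.lt_pow_of_log_lt hb hi)⟩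
  · exact (Primrec.const 0).of_eq fun n => (Nat.log_of_left_le_one hb n).symm

theorem primrecRel_nat_dvd : PrimrecRel ((· ∣ ·) : ℕ → ℕ → Prop) :=
  PrimrecPred.of_eq
    (Primrec.eq.comp (Primrec.nat_mod.comp Primrec.snd Primrec.fst) (Primrec.const 0))
    fun _ => Nat.dvd_iff_mod_eq_zero.symm

theorem primrecPred_iff {α : Type*} [Primcodable α] {p q : α → Prop} (hp : PrimrecPred p)
    (hq : PrimrecPred q) : PrimrecPred fun a => p a ↔ q a :=
  ((hp.and hq).or (hp.not.and hq.not)).of_eq fun _ => iff_iff_and_or_not_and_not.symm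

theorem primrec_countP {α β : Type*} [Primcodable α] [Primcodable β] {R : α → β → Prop}
    [DecidableRel R] (hR : PrimrecRel R) :
    Primrec₂ fun (l : List α) b => l.countP fun a => decide (R a b) :=
  (Primrec.list_length.comp hR.listFilter).of_eq fun _ => List.countP_eq_length_filter.symm

namespace SelfDelimiting

/-- The self-delimiting code of a number: its binary digits, most significant first, each announced
by a `true`, and a final `false`. -/
def encodeNat (x : ℕ) : List Bool :=
  ((List.range (Nat.log 2 x + 1)).flatMap fun i =>
    [true, decide (x / 2 ^ (Nat.log 2 x - i) % 2 = 1)]) ++ [false]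

/-- The self-delimiting code of a list of numbers, as a bit string. -/
def encode (l : List ℕ) : List Bool := l.flatMap encodeNat

/-- One step of the decoder; the state consists of the decoded numbers, the number that is being
read, and whether the next bit is a digit. -/
def decodeStep (s : List ℕ × ℕ × Bool) (b : Bool) : List ℕ × ℕ × Bool :=
  bif s.2.2 then (s.1, 2 * s.2.1 + b.toNat, false)
  else bif b then (s.1, s.2.1, true)
  else (s.1 ++ [s.2.1], 0, false)

/-- The list of numbers read off a bit string, the left inverse of `encode`. -/
def decode (w : List Bool) : List ℕ := (w.foldl decodeStep ([], 0, false)).1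

theorem length_encodeNat (x : ℕ) : (encodeNat x).length = 2 * Nat.log 2 x + 3 := by
  simp only [encodeNat, List.length_append, List.length_flatMap, List.length_cons,
    List.length_nil, List.map_const', List.length_range, List.sum_replicate, smul_eq_mul]
  ring

theorem foldl_decodeStep_digits {x L c : ℕ} (hc : c ≤ L + 1) (hx : x < 2 ^ (L + 1))
    (out : List ℕ) :
    (((List.range c).flatMap fun i => [true, decide (x / 2 ^ (L - i) % 2 = 1)]).foldl decodeStep
      (out, 0, false)) = (out, x / 2 ^ (L + 1 - c), false) := by
  induction c with
  | zero => simp [Nat.div_eq_of_lt hx]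
  | succ c ih =>
    rw [List.range_succ, List.flatMap_append, List.foldl_append, ih (by lia),
      show L + 1 - c = (L - c) + 1 by lia, show L + 1 - (c + 1) = L - c by lia, pow_succ,
      ← Nat.div_div_eq_div_mul]
    simp only [List.flatMap_cons, List.flatMap_nil, List.append_nil, List.foldl_cons,
      List.foldl_nil, decodeStep, cond_false, cond_true, Prod.mk.injEq, true_and, and_true]
    generalize x / 2 ^ (L - c) = y
    rcases Nat.mod_two_eq_zero_or_one y with h | h <;> simp [h] <;> lia

theorem foldl_decodeStep_encodeNat (x : ℕ) (out : List ℕ) :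
    (encodeNat x).foldl decodeStep (out, 0, false) = (out ++ [x], 0, false) := by
  rw [encodeNat, List.foldl_append,
    foldl_decodeStep_digits le_rfl (Nat.lt_pow_succ_log_self one_lt_two x)]
  simp [decodeStep]

theorem foldl_decodeStep_encode (l out : List ℕ) :
    (encode l).foldl decodeStep (out, 0, false) = (out ++ l, 0, false) := by
  induction l generalizing out with
  | nil => simp [encode]
  | cons x l ih =>
    rw [encode, List.flatMap_cons, List.foldl_append, foldl_decodeStep_encodeNat, ← encode, ih,
      List.append_assoc, List.singleton_append]

theorem decode_encode (l : List ℕ) : decode (encode l) = l := by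
  rw [decode, foldl_decodeStep_encode, List.nil_append]

theorem length_encode_le {l : List ℕ} {B : ℕ} (h : ∀ x ∈ l, Nat.log 2 x ≤ B) :
    (encode l).length ≤ l.length * (2 * B + 3) := by
  rw [encode, List.length_flatMap, ← List.length_map (f := fun x => (encodeNat x).length),
    ← smul_eq_mul]
  refine List.sum_le_card_nsmul _ _ fun c hc => ?_
  obtain ⟨x, hx, rfl⟩ := List.mem_map.1 hc
  grind [length_encodeNat]

theorem primrec_encodeNat : Primrec encodeNat := by
  have hlog : Primrec (Nat.log 2) := primrec_nat_log 2
  have hbit : Primrec fun p : ℕ × ℕ => decide (p.1 / 2 ^ (Nat.log 2 p.1 - p.2) % 2 = 1) :=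
    (Primrec.eq.comp (Primrec.nat_mod.comp (Primrec.nat_div.comp Primrec.fst
      (primrec_nat_pow.comp (Primrec.const 2)
        (Primrec.nat_sub.comp (hlog.comp Primrec.fst) Primrec.snd))) (Primrec.const 2))
      (Primrec.const 1)).decide
  exact Primrec.list_append.comp
    (Primrec.list_flatMap (Primrec.list_range.comp (Primrec.succ.comp hlog))
      (Primrec.list_cons.comp (Primrec.const true)
        (Primrec.list_cons.comp hbit (Primrec.const []))))
    (Primrec.const _)

theorem primrec_encode : Primrec encode :=
  Primrec.list_flatMap Primrec.id (primrec_encodeNat.comp Primrec.snd)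

theorem primrec_decodeStep : Primrec₂ decodeStep := by
  have hout : Primrec fun p : (List ℕ × ℕ × Bool) × Bool => p.1.1 :=
    Primrec.fst.comp Primrec.fst
  have hread : Primrec fun p : (List ℕ × ℕ × Bool) × Bool => p.1.2.1 :=
    Primrec.fst.comp (Primrec.snd.comp Primrec.fst)
  have hdigit : Primrec fun p : (List ℕ × ℕ × Bool) × Bool => p.1.2.2 :=
    Primrec.snd.comp (Primrec.snd.comp Primrec.fst)
  refine Primrec.cond hdigit ?_ (Primrec.cond Primrec.snd ?_ ?_)
  · exact hout.pair ((Primrec.nat_add.comp (Primrec.nat_mul.comp (Primrec.const 2) hread)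
      ((Primrec.dom_bool Bool.toNat).comp Primrec.snd)).pair (Primrec.const false))
  · exact hout.pair (hread.pair (Primrec.const true))
  · exact (Primrec.list_append.comp hout
      (Primrec.list_cons.comp hread (Primrec.const []))).pair (Primrec.const _)

theorem primrec_decode : Primrec decode :=
  Primrec.fst.comp (Primrec.list_foldl Primrec.id (Primrec.const _)
    (primrec_decodeStep.comp (Primrec.fst.comp Primrec.snd) (Primrec.snd.comp Primrec.snd)).to₂)

end SelfDelimiting

theorem natPair_lt_two_pow {c d B : ℕ} (hc : c < 2 ^ B) (hd : d < 2 ^ B) :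
    Nat.pair c d < 2 ^ (2 * B) := by
  refine (Nat.pair_lt_max_add_one_sq c d).trans_le ?_
  rw [mul_comm, pow_mul]
  exact Nat.pow_le_pow_left (max_lt hc hd) 2

theorem countP_range_le {p : ℕ → Bool} {h N : ℕ} (hp : ∀ i, p i → i = h) :
    (List.range N).countP p ≤ if p h then 1 else 0 := by
  split_ifs with hh
  · calc (List.range N).countP p ≤ (List.range N).count h :=
        List.countP_mono_left fun i _ hi => beq_iff_eq.2 (hp i hi)
      _ ≤ 1 := List.nodup_iff_count_le_one.1 List.nodup_range h
  · exact (List.countP_eq_zero.2 fun i _ hi => hh (hp i hi ▸ hi)).le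

theorem countP_le_of_forall_countP_le {α : Type*} {l : List α} {p : α → Bool} {f : α → ℕ}
    {r : α → α → Bool} {c : ℕ} (hr : ∀ y z, p y → p z → f y ≤ f z → r y z)
    (hc : ∀ y, p y → l.countP (r y) ≤ c) : l.countP p ≤ c := by
  rcases hmin : (l.filter p).argmin f with - | y
  · rw [List.countP_eq_length_filter, List.argmin_eq_none.1 hmin]
    exact Nat.zero_le c
  · have hy : p y := (List.mem_filter.1 (List.argmin_mem hmin)).2
    exact (List.countP_mono_left fun z hz hpz => hr y z hy hpz
      (List.le_of_mem_argmin (List.mem_filter.2 ⟨hz, hpz⟩) hmin)).trans (hc y hy)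

theorem length_eq_sum_countP {α ι : Type*} [DecidableEq ι] {l : List α} {f : α → ι}
    {s : Finset ι} (hl : ∀ y ∈ l, f y ∈ s) :
    l.length = ∑ i ∈ s, l.countP fun y => decide (f y = i) := by
  induction l with
  | nil => simp
  | cons y l ih =>
    rw [List.forall_mem_cons] at hl
    simp only [List.countP_cons, decide_eq_true_eq, Finset.sum_add_distrib, Finset.sum_ite_eq,
      if_pos hl.1, List.length_cons, ih hl.2]

theorem card_filter_dvd_Ico_mul_le (a b : ℕ) {d : ℕ} (hd : 0 < d) :
    #{z ∈ Finset.Ico (a * d) (b * d) | d ∣ z} ≤ b - a := by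
  have hsub : {z ∈ Finset.Ico (a * d) (b * d) | d ∣ z} ⊆ (Finset.Ico a b).image (d * ·) := by
    intro z hz
    obtain ⟨hz, q, rfl⟩ := Finset.mem_filter.1 hz
    rw [Finset.mem_Ico, mul_comm d, Nat.mul_le_mul_right_iff hd, Nat.mul_lt_mul_right hd] at hz
    exact Finset.mem_image_of_mem _ (Finset.mem_Ico.2 hz)
  calc #{z ∈ Finset.Ico (a * d) (b * d) | d ∣ z} ≤ #((Finset.Ico a b).image (d * ·)) :=
        Finset.card_le_card hsub
    _ ≤ #(Finset.Ico a b) := Finset.card_image_le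
    _ = b - a := Nat.card_Ico a b

/-! ### Rows of slots -/

theorem natLog_le_of_lt_pow {b x w : ℕ} (hb : 1 < b) (hx : x < b ^ w) : Nat.log b x ≤ w :=
  (Nat.log_mono_right hx.le).trans_eq (Nat.log_pow hb w)

theorem four_pow_eq_sq (w : ℕ) : 4 ^ w = 2 ^ w * 2 ^ w := by
  rw [← mul_pow]
  norm_num

/-- The first slot of the row to which the slot `y` belongs: the slots in `[8 ^ i, 8 ^ (i + 1))`
are divided into rows of length `2 ^ i`. -/
def rowStart (y : ℕ) : ℕ := y / 2 ^ Nat.log 8 y * 2 ^ Nat.log 8 y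

theorem rowStart_le (y : ℕ) : rowStart y ≤ y := Nat.div_mul_le_self _ _

theorem pow_log_dvd_rowStart (y : ℕ) : 2 ^ Nat.log 8 y ∣ rowStart y := Dvd.intro_left _ rfl

theorem lt_rowStart_add (y : ℕ) : y < rowStart y + 2 ^ Nat.log 8 y :=
  Nat.lt_div_mul_add (by positivity)

theorem pow_log_le_rowStart {y : ℕ} (hy : y ≠ 0) : 8 ^ Nat.log 8 y ≤ rowStart y := by
  rw [rowStart, show (8 : ℕ) = 4 * 2 by norm_num, mul_pow]
  refine Nat.mul_le_mul_right _ ?_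
  rw [Nat.le_div_iff_mul_le (by positivity), ← mul_pow]
  exact Nat.pow_log_le_self _ hy

theorem log_rowStart (y : ℕ) : Nat.log 8 (rowStart y) = Nat.log 8 y := by
  rcases Nat.eq_zero_or_pos y with rfl | hy
  · rfl
  · exact Nat.log_eq_of_pow_le_of_lt_pow (pow_log_le_rowStart hy.ne')
      ((rowStart_le y).trans_lt (Nat.lt_pow_succ_log_self (by norm_num) y))

theorem rowStart_mono : Monotone rowStart := by
  intro y z h
  rcases (Nat.log_mono_right (b := 8) h).eq_or_lt with heq | hlt
  · unfold rowStart
    rw [heq]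
    exact Nat.mul_le_mul_right _ (Nat.div_le_div_right h)
  · have hz : z ≠ 0 := by
      rintro rfl
      simp at hlt
    calc rowStart y ≤ y := rowStart_le y
      _ ≤ 8 ^ Nat.log 8 z := (Nat.lt_pow_of_log_lt (by norm_num) hlt).le
      _ ≤ rowStart z := pow_log_le_rowStart hz

theorem div_sixtyFour_pow_succ (Y h : ℕ) : Y / 64 ^ (h + 1) = Y / 64 / 64 ^ h := by
  rw [Nat.div_div_eq_div_mul, pow_succ']

theorem log_div_sixtyFour (Y : ℕ) : Nat.log 8 (Y / 64) = Nat.log 8 Y - 2 := by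
  rw [show Y / 64 = Y / 8 / 8 by rw [Nat.div_div_eq_div_mul], Nat.log_div_base, Nat.log_div_base,
    Nat.sub_sub]

theorem sum_two_pow_log_div_le (Y N : ℕ) :
    ∑ h ∈ Finset.range N, 2 ^ Nat.log 8 (Y / 64 ^ h) ≤ 2 * 2 ^ Nat.log 8 Y + N := by
  induction N generalizing Y with
  | zero => simp
  | succ N ih =>
    have htail := ih (Y / 64)
    simp only [Finset.sum_range_succ', div_sixtyFour_pow_succ, pow_zero, Nat.div_one]
    rcases Nat.lt_or_ge (Nat.log 8 Y) 2 with hl | hl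
    · rw [log_div_sixtyFour, Nat.sub_eq_zero_of_le hl.le] at htail
      have := Nat.one_le_two_pow (n := Nat.log 8 Y)
      lia
    · have : 2 ^ Nat.log 8 Y = 4 * 2 ^ Nat.log 8 (Y / 64) := by
        rw [log_div_sixtyFour, show 4 = 2 ^ 2 by norm_num, ← pow_add, Nat.add_sub_cancel' hl]
      lia

theorem sum_two_pow_log_div_ite_le (Y N b : ℕ) :
    ∑ h ∈ Finset.range N, (if Y / 64 ^ h < 8 ^ b then 2 ^ Nat.log 8 (Y / 64 ^ h) else 0) ≤
      2 * 2 ^ b + N := by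
  induction N generalizing Y with
  | zero => simp
  | succ N ih =>
    rcases Nat.lt_or_ge Y (8 ^ b) with hY | hY
    · calc _ ≤ ∑ h ∈ Finset.range (N + 1), 2 ^ Nat.log 8 (Y / 64 ^ h) := by
            gcongr
            split_ifs <;> simp
        _ ≤ 2 * 2 ^ Nat.log 8 Y + (N + 1) := sum_two_pow_log_div_le Y (N + 1)
        _ ≤ 2 * 2 ^ b + (N + 1) := by
            gcongr
            · norm_num
            · exact natLog_le_of_lt_pow (by norm_num) hY
    · simp only [Finset.sum_range_succ', div_sixtyFour_pow_succ, pow_zero, Nat.div_one,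
        if_neg (not_lt.2 hY), add_zero]
      exact (ih (Y / 64)).trans (by lia)

theorem sum_eight_pow_ite_le (N b : ℕ) :
    ∑ h ∈ Finset.range N, (if 3 * h ≤ b then 8 ^ h else 0) ≤ 2 * 2 ^ b := by
  have hsum : ∑ h ∈ Finset.range N with 3 * h ≤ b, 8 ^ h =
      ∑ j ∈ {h ∈ Finset.range N | 3 * h ≤ b}.image (3 * ·), 2 ^ j := by
    rw [Finset.sum_image fun i _ j _ hij => by simpa using hij]
    exact Finset.sum_congr rfl fun h _ => by
      rw [pow_mul]
      norm_num
  rw [← Finset.sum_filter, hsum, ← pow_succ']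
  refine (Nat.geomSum_lt le_rfl ?_).le
  simp only [Finset.mem_image, Finset.mem_filter]
  rintro _ ⟨h, ⟨-, hh⟩, rfl⟩
  lia

/-! ### The sampler -/

/-- A counter of the sampler. It is born when an element is sampled. -/
structure Counter where
  /-- the level of the counter; at level `h` an element is sampled with probability `64⁻¹ ^ h` -/
  level : ℕ
  /-- the sampled element -/
  element : ℕ
  /-- the number of occurrences of the element since it was sampled -/
  count : ℕ
  /-- the row in which the element was sampled -/
  row : ℕ

namespace Counter

/-- A counter after the arrival of `x`. -/
def observe (x : ℕ) (y : Counter) : Counter :=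
  { y with count := if y.element = x then y.count + 1 else y.count }

/-- A counter as the tuple of its fields, by which counters are coded as numbers. -/
def equivProd : Counter ≃ ℕ × ℕ × ℕ × ℕ where
  toFun y := (y.level, y.element, y.count, y.row)
  invFun t := ⟨t.1, t.2.1, t.2.2.1, t.2.2.2⟩

instance : Primcodable Counter := Primcodable.ofEquiv _ equivProd

theorem encode_eq (y : Counter) :
    Encodable.encode y = Nat.pair y.level (Nat.pair y.element (Nat.pair y.count y.row)) := rfl

section Primrec

theorem primrec_equivProd : Primrec equivProd := Primrec.of_equiv

theorem primrec_level : Primrec level := Primrec.fst.comp primrec_equivProd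

theorem primrec_element : Primrec element :=
  Primrec.fst.comp (Primrec.snd.comp primrec_equivProd)

theorem primrec_count : Primrec count :=
  Primrec.fst.comp (Primrec.snd.comp (Primrec.snd.comp primrec_equivProd))

theorem primrec_row : Primrec row :=
  Primrec.snd.comp (Primrec.snd.comp (Primrec.snd.comp primrec_equivProd))

theorem primrec_mk {α : Type*} [Primcodable α] {h i c r : α → ℕ} (hh : Primrec h)
    (hi : Primrec i) (hc : Primrec c) (hr : Primrec r) :
    Primrec fun t => Counter.mk (h t) (i t) (c t) (r t) :=
  Primrec.of_equiv_symm.comp (hh.pair (hi.pair (hc.pair hr)))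

theorem primrec_observe : Primrec₂ observe := by
  have helement := primrec_element.comp (Primrec.snd (α := ℕ))
  have hcount := primrec_count.comp (Primrec.snd (α := ℕ))
  exact primrec_mk (primrec_level.comp Primrec.snd) helement
    (Primrec.ite (Primrec.eq.comp helement Primrec.fst) (Primrec.succ.comp hcount) hcount)
    (primrec_row.comp Primrec.snd)

end Primrec

end Counter

/-- A state of the sampler: the time and the list of the counters. -/
abbrev SamplerState := ℕ × List Counter

namespace SamplerState

/-- The bit string that represents a state of the sampler. -/
def toBits (s : SamplerState) : List Bool :=
  SelfDelimiting.encode (s.1 :: s.2.map Encodable.encode)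

/-- The state of the sampler represented by a bit string. -/
def ofBits (w : List Bool) : SamplerState :=
  ((SelfDelimiting.decode w).headI,
    (SelfDelimiting.decode w).tail.filterMap Encodable.decode)

theorem ofBits_toBits (s : SamplerState) : ofBits (toBits s) = s := by
  simp [ofBits, toBits, SelfDelimiting.decode_encode]

theorem primrec_toBits : Primrec toBits :=
  SelfDelimiting.primrec_encode.comp (Primrec.list_cons.comp Primrec.fst
    (Primrec.list_map Primrec.snd (Primrec.encode.comp Primrec.snd).to₂))

theorem primrec_ofBits : Primrec ofBits :=
  (Primrec.list_headI.comp SelfDelimiting.primrec_decode).pair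
    (Primrec.listFilterMap (Primrec.list_tail.comp SelfDelimiting.primrec_decode)
      (Primrec.decode.comp Primrec.snd).to₂)

end SamplerState

/-- The better of a pair `(i, f̃_i)` and the one given by a counter, according to `f̃_i`. -/
def better (y : Counter) (o : ℕ × ℕ) : ℕ × ℕ :=
  if o.2 < y.count then (y.element, y.count) else o

/-- The element of a largest counter, together with its count, and `(1, 0)` if there is none. -/
def best (l : List Counter) : ℕ × ℕ := l.foldr better (1, 0)

theorem primrec_best : Primrec best := by
  have hcount := Counter.primrec_count.comp (Primrec.fst (β := ℕ × ℕ))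
  have hbetter : Primrec₂ better :=
    Primrec.ite (Primrec.nat_lt.comp (Primrec.snd.comp Primrec.snd) hcount)
      ((Counter.primrec_element.comp Primrec.fst).pair hcount) Primrec.snd
  exact Primrec.list_foldr Primrec.id (Primrec.const (1, 0)) (hbetter.comp₂
    (Primrec.fst.comp Primrec.snd).to₂ (Primrec.snd.comp Primrec.snd).to₂)

theorem best_mem_or (l : List Counter) :
    best l = (1, 0) ∨ ∃ y ∈ l, best l = (y.element, y.count) := by
  induction l with
  | nil => exact Or.inl rfl
  | cons y l ih => grind [best, better]

theorem le_best {l : List Counter} {y : Counter} (hy : y ∈ l) : y.count ≤ (best l).2 := by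
  induction l with
  | nil => cases hy
  | cons z l ih => grind [best, better]

/-- The parameters of the sampler. -/
structure Sampler where
  /-- the exponent of the frequency moment -/
  k : ℕ
  /-- the length of the stream is at most `n ^ a` -/
  a : ℕ
  /-- the factor by which the slots are stretched -/
  slotScale : ℕ
  /-- the factor by which the capacities are enlarged -/
  capacityScale : ℕ

namespace Sampler

variable (S : Sampler)

/-- The least integer above the logarithm of `n` to the base `4 ^ k`: `4 ^ base` is about
`n ^ (1 / k)`. -/
def base (n : ℕ) : ℕ := Nat.log (4 ^ S.k) n + 1

/-- The largest level. The counters of level `h` aim at the frequencies of order `64 ^ h`. -/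
def top (n : ℕ) : ℕ := S.a * S.k * S.base n

/-- The number of octaves `[8 ^ i, 8 ^ (i + 1))` of slots in which level `h` is active. -/
def width (n h : ℕ) : ℕ := min (3 * h) (S.base n)

/-- The number of arrivals that make up a slot of level `h`. -/
def slotLength (n h : ℕ) : ℕ := S.slotScale * 64 ^ h * 2 ^ (S.width n h * (2 * S.k - 5))

/-- The capacity of level `h` in its first slots, which is also its factor in every slot. -/
def minCapacity (n h : ℕ) : ℕ := S.capacityScale * 2 ^ (S.width n h * (2 * S.k - 5))

/-- The number of counters of level `h` allowed in the slot `y`. -/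
def capacity (n h y : ℕ) : ℕ :=
  if y < 8 ^ S.width n h then S.minCapacity n h * 2 ^ Nat.log 8 y else 0

/-- The toll of level `h` to be paid when the slot `y` begins: it is due at the first slot of each
row. -/
def toll (n h y : ℕ) : ℕ :=
  if 2 ^ Nat.log 8 y ∣ y then 4 ^ (3 * h - S.width n h) * 2 ^ (S.width n h - Nat.log 8 y) else 0

/-- The total toll of level `h` in the slots `1, …, y`. -/
def totalToll (n h y : ℕ) : ℕ := ∑ z ∈ Finset.Ioc 0 y, S.toll n h z

/-- The row of level `h` to which the time `τ` belongs. -/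
def row (n h τ : ℕ) : ℕ := rowStart (τ / S.slotLength n h)

/-- The rank of a counter: a younger counter is credited with the toll that was due before its
birth, so that an older one has to have counted that much more. -/
def rank (n : ℕ) (y : Counter) : ℕ := y.count + S.totalToll n y.level y.row

/-- At time `τ` the counter `z` competes with `y` and is at least as good. Only counters of the same
level compete, and the counters born in the current row do not compete with the older ones. -/
def Beats (n τ : ℕ) (y z : Counter) : Prop :=
  z.level = y.level ∧ (z.row = S.row n y.level τ ↔ y.row = S.row n y.level τ) ∧
    S.rank n y ≤ S.rank n z

instance (n τ : ℕ) : DecidableRel (S.Beats n τ) :=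
  fun _ _ => inferInstanceAs (Decidable (_ ∧ _ ∧ _))

/-- The counters that are born at time `τ`, when `x` arrives and the random number is `u`. -/
def births (n τ x u : ℕ) : List Counter :=
  ((List.range (S.top n + 1)).filter fun h => 64 ^ h ∣ u).map fun h => ⟨h, x, 1, S.row n h τ⟩

/-- The counters of a list that are kept at time `τ`. -/
def select (n τ : ℕ) (l : List Counter) : List Counter :=
  l.filter fun y => l.countP (fun z => S.Beats n τ y z) ≤
    S.capacity n y.level (τ / S.slotLength n y.level)

/-- The state of the sampler after the arrival of `x`, when the random number is `u`. -/
def advance (n : ℕ) (s : SamplerState) (x u : ℕ) : SamplerState :=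
  (s.1 + 1, S.select n s.1 (s.2.map (Counter.observe x) ++ S.births n s.1 x u))

section Primrec

variable {α : Type*} [Primcodable α] {n h τ x u y : α → ℕ}

theorem primrec_base (hn : Primrec n) : Primrec fun i => S.base (n i) :=
  Primrec.succ.comp ((primrec_nat_log _).comp hn)

theorem primrec_top (hn : Primrec n) : Primrec fun i => S.top (n i) :=
  Primrec.nat_mul.comp (Primrec.const _) (S.primrec_base hn)

theorem primrec_width (hn : Primrec n) (hh : Primrec h) : Primrec fun i => S.width (n i) (h i) :=
  Primrec.nat_min.comp (Primrec.nat_mul.comp (Primrec.const 3) hh) (S.primrec_base hn)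

theorem primrec_two_pow_width (hn : Primrec n) (hh : Primrec h) :
    Primrec fun i => 2 ^ (S.width (n i) (h i) * (2 * S.k - 5)) :=
  primrec_nat_pow.comp (Primrec.const 2)
    (Primrec.nat_mul.comp (S.primrec_width hn hh) (Primrec.const _))

theorem primrec_slotLength (hn : Primrec n) (hh : Primrec h) :
    Primrec fun i => S.slotLength (n i) (h i) :=
  Primrec.nat_mul.comp (Primrec.nat_mul.comp (Primrec.const _)
    (primrec_nat_pow.comp (Primrec.const 64) hh)) (S.primrec_two_pow_width hn hh)

theorem primrec_slot (hn : Primrec n) (hh : Primrec h) (hτ : Primrec τ) :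
    Primrec fun i => τ i / S.slotLength (n i) (h i) :=
  Primrec.nat_div.comp hτ (S.primrec_slotLength hn hh)

theorem primrec_two_pow_log (hy : Primrec y) : Primrec fun i => 2 ^ Nat.log 8 (y i) :=
  primrec_nat_pow.comp (Primrec.const 2) ((primrec_nat_log 8).comp hy)

theorem primrec_capacity (hn : Primrec n) (hh : Primrec h) (hy : Primrec y) :
    Primrec fun i => S.capacity (n i) (h i) (y i) :=
  Primrec.ite
    (Primrec.nat_lt.comp hy (primrec_nat_pow.comp (Primrec.const 8) (S.primrec_width hn hh)))
    (Primrec.nat_mul.comp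
      (Primrec.nat_mul.comp (Primrec.const _) (S.primrec_two_pow_width hn hh))
      (primrec_two_pow_log hy))
    (Primrec.const 0)

theorem primrec_toll (hn : Primrec n) (hh : Primrec h) (hy : Primrec y) :
    Primrec fun i => S.toll (n i) (h i) (y i) := by
  have hwidth := S.primrec_width hn hh
  exact Primrec.ite (primrecRel_nat_dvd.comp (primrec_two_pow_log hy) hy)
    (Primrec.nat_mul.comp
      (primrec_nat_pow.comp (Primrec.const 4)
        (Primrec.nat_sub.comp (Primrec.nat_mul.comp (Primrec.const 3) hh) hwidth))
      (primrec_nat_pow.comp (Primrec.const 2)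
        (Primrec.nat_sub.comp hwidth ((primrec_nat_log 8).comp hy))))
    (Primrec.const 0)

theorem totalToll_succ (n h y : ℕ) :
    S.totalToll n h (y + 1) = S.totalToll n h y + S.toll n h (y + 1) :=
  Finset.sum_Ioc_succ_top (Nat.zero_le y) _

theorem primrec_totalToll (hn : Primrec n) (hh : Primrec h) (hy : Primrec y) :
    Primrec fun i => S.totalToll (n i) (h i) (y i) := by
  have hstep : Primrec₂ fun (i : α) (p : ℕ × ℕ) => p.2 + S.toll (n i) (h i) (p.1 + 1) :=
    Primrec.nat_add.comp (Primrec.snd.comp Primrec.snd)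
      (S.primrec_toll (hn.comp Primrec.fst) (hh.comp Primrec.fst)
        (Primrec.succ.comp (Primrec.fst.comp Primrec.snd)))
  refine (Primrec.nat_rec' hy (Primrec.const 0) hstep).of_eq fun i => ?_
  induction y i with
  | zero => rfl
  | succ z ih => rw [totalToll_succ, ← ih]

theorem primrec_row (hn : Primrec n) (hh : Primrec h) (hτ : Primrec τ) :
    Primrec fun i => S.row (n i) (h i) (τ i) := by
  have hslot := S.primrec_slot hn hh hτ
  exact Primrec.nat_mul.comp (Primrec.nat_div.comp hslot (primrec_two_pow_log hslot))
    (primrec_two_pow_log hslot)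

theorem primrec_rank {y : α → Counter} (hn : Primrec n) (hy : Primrec y) :
    Primrec fun i => S.rank (n i) (y i) :=
  Primrec.nat_add.comp (Counter.primrec_count.comp hy)
    (S.primrec_totalToll hn (Counter.primrec_level.comp hy) (Counter.primrec_row.comp hy))

theorem primrecPred_beats {y z : α → Counter} (hn : Primrec n) (hτ : Primrec τ)
    (hy : Primrec y) (hz : Primrec z) :
    PrimrecPred fun i => S.Beats (n i) (τ i) (y i) (z i) := by
  have hlevel := Counter.primrec_level.comp hy
  have hcurrent := S.primrec_row hn hlevel hτ
  exact (Primrec.eq.comp (Counter.primrec_level.comp hz) hlevel).and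
    ((primrecPred_iff (Primrec.eq.comp (Counter.primrec_row.comp hz) hcurrent)
      (Primrec.eq.comp (Counter.primrec_row.comp hy) hcurrent)).and
      (Primrec.nat_le.comp (S.primrec_rank hn hy) (S.primrec_rank hn hz)))

theorem primrec_births (hn : Primrec n) (hτ : Primrec τ) (hx : Primrec x) (hu : Primrec u) :
    Primrec fun i => S.births (n i) (τ i) (x i) (u i) := by
  have hdvd : PrimrecRel fun h u : ℕ => 64 ^ h ∣ u :=
    primrecRel_nat_dvd.comp (primrec_nat_pow.comp (Primrec.const 64) Primrec.fst) Primrec.snd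
  exact Primrec.list_map
    (hdvd.listFilter.comp (Primrec.list_range.comp (Primrec.succ.comp (S.primrec_top hn))) hu)
    (Counter.primrec_mk Primrec.snd (hx.comp Primrec.fst) (Primrec.const 1)
      (S.primrec_row (hn.comp Primrec.fst) Primrec.snd (hτ.comp Primrec.fst)))

theorem primrec_select {l : α → List Counter} (hn : Primrec n) (hτ : Primrec τ)
    (hl : Primrec l) : Primrec fun i => S.select (n i) (τ i) (l i) := by
  have hbeats : PrimrecRel fun (z : Counter) (p : Counter × α) =>
      S.Beats (n p.2) (τ p.2) p.1 z :=
    S.primrecPred_beats (hn.comp (Primrec.snd.comp Primrec.snd))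
      (hτ.comp (Primrec.snd.comp Primrec.snd)) (Primrec.fst.comp Primrec.snd) Primrec.fst
  have hn' : Primrec fun p : Counter × α => n p.2 := hn.comp Primrec.snd
  have hlevel : Primrec fun p : Counter × α => p.1.level :=
    Counter.primrec_level.comp Primrec.fst
  have hkeep : PrimrecRel fun (y : Counter) (i : α) =>
      (l i).countP (fun z => S.Beats (n i) (τ i) y z) ≤
        S.capacity (n i) y.level (τ i / S.slotLength (n i) y.level) :=
    Primrec.nat_le.comp ((primrec_countP hbeats).comp (hl.comp Primrec.snd) Primrec.id)
      (S.primrec_capacity hn' hlevel (S.primrec_slot hn' hlevel (hτ.comp Primrec.snd)))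
  exact hkeep.listFilter.comp hl Primrec.id

theorem primrec_advance {s : α → SamplerState} (hn : Primrec n) (hs : Primrec s)
    (hx : Primrec x) (hu : Primrec u) : Primrec fun i => S.advance (n i) (s i) (x i) (u i) := by
  have htime := Primrec.fst.comp hs
  exact (Primrec.succ.comp htime).pair (S.primrec_select hn htime (Primrec.list_append.comp
    (Primrec.list_map (Primrec.snd.comp hs)
      (Counter.primrec_observe.comp (hx.comp Primrec.fst) Primrec.snd).to₂)
    (S.primrec_births hn htime hx hu)))

end Primrec

/-- The random numbers are drawn from `{0, …, maxRandom}`. -/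
def maxRandom (n : ℕ) : ℕ := 64 ^ S.top n - 1

/-- The streaming algorithm that runs the sampler. -/
def algorithm : StreamingAlgorithm where
  init _ := SamplerState.toBits (0, [])
  range p := S.maxRandom p.1
  update p := SamplerState.toBits (S.advance p.1.1 (SamplerState.ofBits p.1.2.1) p.1.2.2 p.2)
  output p := best (SamplerState.ofBits p.2).2
  computable_init := Computable.const _
  computable_range := (Primrec.nat_sub.comp (primrec_nat_pow.comp (Primrec.const 64)
    (S.primrec_top Primrec.fst)) (Primrec.const 1)).to_comp
  computable_update := by
    have hinput : Primrec fun p : (ℕ × List Bool × ℕ) × ℕ => p.1 := Primrec.fst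
    have hmemory := Primrec.snd.comp hinput
    exact (SamplerState.primrec_toBits.comp (S.primrec_advance (Primrec.fst.comp hinput)
      (SamplerState.primrec_ofBits.comp (Primrec.fst.comp hmemory)) (Primrec.snd.comp hmemory)
      Primrec.snd)).to_comp
  computable_output := (primrec_best.comp (Primrec.snd.comp
    (SamplerState.primrec_ofBits.comp Primrec.snd))).to_comp

end Sampler

/-! ### The law of the memory -/

theorem uniformOfFintype_pi_succ (α : Type*) [Fintype α] [Nonempty α] (m : ℕ) :
    PMF.uniformOfFintype (Fin (m + 1) → α) =
      (PMF.uniformOfFintype (Fin m → α)).bind fun ω =>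
        (PMF.uniformOfFintype α).map fun a => Fin.snoc (α := fun _ => α) ω a := by
  classical
  ext ω
  simp only [PMF.bind_apply, PMF.map_apply, PMF.uniformOfFintype_apply, tsum_fintype]
  rw [Finset.sum_eq_single (Fin.init ω), Finset.sum_eq_single (ω (Fin.last m))]
  · rw [Fin.snoc_init_self, if_pos rfl, ← ENNReal.mul_inv (Or.inr (by simp)) (Or.inr (by simp))]
    simp [pow_succ]
  · intro a _ ha
    refine if_neg fun h => ha ?_
    rw [h, Fin.snoc_last]
  · simp
  · intro ω' _ hω'
    rw [Finset.sum_eq_zero, mul_zero]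
    refine fun a _ => if_neg fun h => hω' ?_
    rw [h, Fin.init_snoc]
  · simp

/-- A finite sequence of numbers below `N`, continued by zeros. -/
def zeroExtend {m N : ℕ} (ω : Fin m → Fin N) (t : ℕ) : ℕ := if h : t < m then ω ⟨t, h⟩ else 0

theorem zeroExtend_snoc_last {m N : ℕ} (ω : Fin m → Fin N) (u : Fin N) :
    zeroExtend (Fin.snoc (α := fun _ => Fin N) ω u) m = u := by
  simp [zeroExtend, Fin.snoc]

theorem zeroExtend_snoc_of_lt {m N : ℕ} (ω : Fin m → Fin N) (u : Fin N) {t : ℕ} (ht : t < m) :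
    zeroExtend (Fin.snoc (α := fun _ => Fin N) ω u) t = zeroExtend ω t := by
  simp [zeroExtend, Fin.snoc, ht, Nat.lt_succ_of_lt ht]

namespace Sampler

variable (S : Sampler) (n : ℕ)

/-- The state after `T` steps, for the stream `x 0, x 1, …` and the random numbers
`ω 0, ω 1, …`. -/
def state (x ω : ℕ → ℕ) : ℕ → SamplerState
  | 0 => (0, [])
  | T + 1 => S.advance n (state x ω T) (x T) (ω T)

theorem state_congr {x ω ω' : ℕ → ℕ} {T : ℕ} (h : ∀ t < T, ω t = ω' t) :
    S.state n x ω T = S.state n x ω' T := by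
  induction T with
  | zero => rfl
  | succ T ih => rw [state, state, ih fun t ht => h t (ht.trans T.lt_succ_self), h T T.lt_succ_self]

/-- The sequences of random numbers that the sampler may draw in `m` steps. -/
abbrev Randoms (m : ℕ) : Type := Fin m → Fin (S.maxRandom n + 1)

theorem algorithm_step_eq (w : List Bool) (x : ℕ) : S.algorithm.step n w x =
    (PMF.uniformOfFintype (Fin (S.maxRandom n + 1))).map
      fun u : Fin (S.maxRandom n + 1) => S.algorithm.update ((n, w, x), (u : ℕ)) := by
  change PMF.map (fun u : ℕ => S.algorithm.update ((n, w, x), u))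
    ((PMF.uniformOfFintype (Fin (S.maxRandom n + 1))).bind fun u => PMF.pure (u : ℕ)) = _
  simp only [PMF.map_bind, PMF.pure_map]
  rfl

theorem algorithm_run_eq (x : ℕ → ℕ) (m : ℕ) :
    S.algorithm.run n ((List.range m).map x) =
      (PMF.uniformOfFintype (S.Randoms n m)).map
        fun ω => SamplerState.toBits (S.state n x (zeroExtend ω) m) := by
  induction m with
  | zero =>
    have hconst : (fun ω : S.Randoms n 0 => SamplerState.toBits (S.state n x (zeroExtend ω) 0)) =
        Function.const _ (SamplerState.toBits (0, [])) := rfl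
    rw [hconst, PMF.map_const]
    rfl
  | succ m ih =>
    have hrun : S.algorithm.run n ((List.range (m + 1)).map x) =
        (S.algorithm.run n ((List.range m).map x)).bind
          fun w => S.algorithm.step n w (x m) := by
      rw [List.range_succ, List.map_append, StreamingAlgorithm.run, List.foldl_append]
      rfl
    rw [hrun, ih, PMF.bind_map, uniformOfFintype_pi_succ, PMF.map_bind]
    congr 1
    funext ω
    rw [PMF.map_comp, Function.comp_apply, algorithm_step_eq]
    congr 1
    funext u
    simp only [Function.comp_apply, algorithm, SamplerState.ofBits_toBits, state,
      zeroExtend_snoc_last, S.state_congr n fun _ ht => zeroExtend_snoc_of_lt ω u ht]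

theorem algorithm_answer_eq (x : ℕ → ℕ) (m : ℕ) :
    S.algorithm.answer n ((List.range m).map x) =
      (PMF.uniformOfFintype (S.Randoms n m)).map
        fun ω => best (S.state n x (zeroExtend ω) m).2 := by
  rw [StreamingAlgorithm.answer, algorithm_run_eq, PMF.map_comp]
  congr 1
  funext ω
  exact congrArg (fun s : SamplerState => best s.2) (SamplerState.ofBits_toBits _)

end Sampler

/-! ### Evolution of the counters -/

/-- The number of times `w ∈ [u, T)` with `x w = x u`. -/
def occ (x : ℕ → ℕ) (u T : ℕ) : ℕ := #{w ∈ Finset.Ico u T | x w = x u}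

/-- The frequency of `j` among `x 0, …, x (m - 1)`. -/
def freq (x : ℕ → ℕ) (m j : ℕ) : ℕ := #{w ∈ Finset.range m | x w = j}

theorem occ_succ {x : ℕ → ℕ} {u T : ℕ} (h : u ≤ T) :
    occ x u (T + 1) = if x u = x T then occ x u T + 1 else occ x u T := by
  rw [occ, occ, ← Finset.insert_Ico_right_eq_Ico_add_one h, Finset.filter_insert]
  split_ifs with h₁ h₂ h₂
  · rw [Finset.card_insert_of_notMem (by simp)]
  · exact absurd h₁.symm h₂
  · exact absurd h₂.symm h₁
  · rfl

theorem occ_self_succ (x : ℕ → ℕ) (u : ℕ) : occ x u (u + 1) = 1 := by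
  rw [occ_succ le_rfl, if_pos rfl]
  simp [occ]

theorem occ_le_freq (x : ℕ → ℕ) (u m : ℕ) : occ x u m ≤ freq x m (x u) := by
  refine Finset.card_le_card (Finset.filter_subset_filter _ ?_)
  rw [Finset.range_eq_Ico]
  exact Finset.Ico_subset_Ico_left (Nat.zero_le u)

theorem occ_le (x : ℕ → ℕ) (u T : ℕ) : occ x u T ≤ T :=
  (occ_le_freq x u T).trans ((Finset.card_filter_le _ _).trans_eq (Finset.card_range T))

theorem freq_mono (x : ℕ → ℕ) (j : ℕ) : Monotone fun m => freq x m j := fun _ _ hm =>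
  Finset.card_le_card (Finset.filter_subset_filter _ (Finset.range_mono hm))

/-- The times before `T` when a counter of level `h` is born. -/
def hits (ω : ℕ → ℕ) (h T : ℕ) : Finset ℕ := {v ∈ Finset.range T | 64 ^ h ∣ ω v}

namespace Sampler

variable (S : Sampler) (n : ℕ)

theorem state_fst (x ω : ℕ → ℕ) (T : ℕ) : (S.state n x ω T).1 = T := by
  induction T with
  | zero => rfl
  | succ T ih => rw [state, advance, ih]

/-- What has become, after `T` steps, of the counter of level `h` born at time `u`, if it has never
been dropped. -/
def counter (x : ℕ → ℕ) (T u h : ℕ) : Counter := ⟨h, x u, occ x u T, S.row n h u⟩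

/-- What has become, after `T` steps, of the counters born at time `u`, if none has been dropped. -/
def countersBornAt (x ω : ℕ → ℕ) (T u : ℕ) : List Counter :=
  ((List.range (S.top n + 1)).filter fun h => 64 ^ h ∣ ω u).map fun h => S.counter n x T u h

/-- The counters after `T` steps if none is ever dropped. -/
def allCounters (x ω : ℕ → ℕ) (T : ℕ) : List Counter :=
  (List.range T).flatMap fun u => S.countersBornAt n x ω T u

theorem observe_counter (x : ℕ → ℕ) {T u : ℕ} (h : ℕ) (hu : u ≤ T) :
    (S.counter n x T u h).observe (x T) = S.counter n x (T + 1) u h := by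
  rw [counter, counter, occ_succ hu]
  rfl

theorem countersBornAt_succ_self (x ω : ℕ → ℕ) (T : ℕ) :
    S.countersBornAt n x ω (T + 1) T = S.births n T (x T) (ω T) := by
  simp only [countersBornAt, births, counter, occ_self_succ]

theorem allCounters_succ (x ω : ℕ → ℕ) (T : ℕ) :
    S.allCounters n x ω (T + 1) =
      (S.allCounters n x ω T).map (Counter.observe (x T)) ++ S.births n T (x T) (ω T) := by
  rw [allCounters, allCounters, List.range_succ (n := T), List.flatMap_append, List.map_flatMap,
    List.flatMap_singleton, countersBornAt_succ_self]
  congr 1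
  refine List.flatMap_congr fun u hu => ?_
  rw [countersBornAt, countersBornAt, List.map_map]
  exact List.map_congr_left fun h _ => (S.observe_counter n x h (List.mem_range.1 hu).le).symm

/-- The counters at time `T` before the selection. -/
def candidates (x ω : ℕ → ℕ) (T : ℕ) : List Counter :=
  (S.state n x ω T).2.map (Counter.observe (x T)) ++ S.births n T (x T) (ω T)

theorem state_succ_snd (x ω : ℕ → ℕ) (T : ℕ) :
    (S.state n x ω (T + 1)).2 = S.select n T (S.candidates n x ω T) := by
  rw [state, advance, state_fst]
  rfl

theorem state_sublist (x ω : ℕ → ℕ) (T : ℕ) :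
    (S.state n x ω T).2.Sublist (S.allCounters n x ω T) := by
  induction T with
  | zero => exact List.Sublist.refl _
  | succ T ih =>
    rw [state_succ_snd, allCounters_succ]
    exact List.filter_sublist.trans ((ih.map _).append (List.Sublist.refl _))

theorem candidates_sublist (x ω : ℕ → ℕ) (T : ℕ) :
    (S.candidates n x ω T).Sublist (S.allCounters n x ω (T + 1)) := by
  rw [allCounters_succ]
  exact ((S.state_sublist n x ω T).map _).append (List.Sublist.refl _)

theorem mem_allCounters {x ω : ℕ → ℕ} {T : ℕ} {y : Counter} (hy : y ∈ S.allCounters n x ω T) :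
    ∃ u < T, ∃ h ≤ S.top n, y = S.counter n x T u h := by
  simp only [allCounters, countersBornAt, List.mem_flatMap, List.mem_map, List.mem_filter,
    List.mem_range] at hy
  obtain ⟨u, hu, h, ⟨hh, -⟩, rfl⟩ := hy
  exact ⟨u, hu, h, Nat.lt_succ_iff.1 hh, rfl⟩

theorem countP_countersBornAt_le (x ω : ℕ → ℕ) (T u : ℕ) {h : ℕ} {p : Counter → Bool}
    (hp : ∀ y, p y → y.level = h) :
    (S.countersBornAt n x ω T u).countP p ≤
      if 64 ^ h ∣ ω u ∧ p (S.counter n x T u h) then 1 else 0 := by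
  rw [countersBornAt, List.countP_map, List.countP_filter]
  refine (countP_range_le (h := h) fun i hi => ?_).trans_eq ?_
  · exact hp _ (Bool.and_eq_true_iff.1 hi).1
  · simp only [Function.comp_apply, Bool.and_eq_true, decide_eq_true_eq, and_comm]

theorem countP_allCounters_le (x ω : ℕ → ℕ) (T : ℕ) {h : ℕ} {p : Counter → Bool}
    (hp : ∀ y, p y → y.level = h) :
    (S.allCounters n x ω T).countP p ≤ #{v ∈ hits ω h T | p (S.counter n x T v h)} := by
  rw [allCounters, List.countP_flatMap, hits, Finset.filter_filter, Finset.card_filter]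
  change ∑ u ∈ Finset.range T, (S.countersBornAt n x ω T u).countP p ≤ _
  exact Finset.sum_le_sum fun u _ => S.countP_countersBornAt_le n x ω T u hp

theorem counter_mem_candidates (x : ℕ → ℕ) {ω : ℕ → ℕ} {T u h : ℕ} (hh : h ≤ S.top n)
    (hω : 64 ^ h ∣ ω u) (hu : u ≤ T)
    (hmem : u < T → S.counter n x T u h ∈ (S.state n x ω T).2) :
    S.counter n x (T + 1) u h ∈ S.candidates n x ω T := by
  rcases hu.eq_or_lt with rfl | hu
  · refine List.mem_append_right _ (List.mem_map.2 ⟨h, ?_, ?_⟩)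
    · exact List.mem_filter.2 ⟨List.mem_range.2 (Nat.lt_succ_iff.2 hh), decide_eq_true hω⟩
    · rw [counter, occ_self_succ]
  · rw [← S.observe_counter n x h hu.le]
    exact List.mem_append_left _ (List.mem_map_of_mem (hmem hu))

theorem counter_mem_state (x : ℕ → ℕ) {ω : ℕ → ℕ} {u h m : ℕ} (hh : h ≤ S.top n)
    (hω : 64 ^ h ∣ ω u) (hu : u < m)
    (hfew : ∀ T, u ≤ T → T < m →
      #{v ∈ hits ω h (T + 1) | S.Beats n T (S.counter n x (T + 1) u h)
        (S.counter n x (T + 1) v h)} ≤ S.capacity n h (T / S.slotLength n h)) :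
    S.counter n x m u h ∈ (S.state n x ω m).2 := by
  induction m with
  | zero => exact absurd hu (Nat.not_lt_zero u)
  | succ m ih =>
    rw [state_succ_snd, select, List.mem_filter, decide_eq_true_eq]
    constructor
    · exact S.counter_mem_candidates n x hh hω (Nat.lt_succ_iff.1 hu) fun hum =>
        ih hum fun T huT hTm => hfew T huT (hTm.trans m.lt_succ_self)
    · calc _ ≤ _ := (S.candidates_sublist n x ω m).countP_le
        _ ≤ _ := S.countP_allCounters_le n x ω (m + 1) (h := h)
          fun y hy => (of_decide_eq_true hy).1
        _ ≤ S.capacity n h (m / S.slotLength n h) := by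
          simpa only [decide_eq_true_eq] using hfew m (Nat.lt_succ_iff.1 hu) m.lt_succ_self

theorem best_state (x ω : ℕ → ℕ) (m : ℕ) :
    best (S.state n x ω m).2 = (1, 0) ∨
      ∃ u < m, (best (S.state n x ω m).2).1 = x u ∧
        (best (S.state n x ω m).2).2 ≤ freq x m (x u) := by
  refine (best_mem_or _).imp_right ?_
  rintro ⟨y, hy, hbest⟩
  obtain ⟨u, hu, h, -, rfl⟩ := S.mem_allCounters n ((S.state_sublist n x ω m).subset hy)
  rw [hbest]
  exact ⟨u, hu, rfl, occ_le_freq x u m⟩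

/-! ### Space -/

theorem row_mono (h : ℕ) : Monotone (S.row n h) :=
  fun _ _ hτ => rowStart_mono (Nat.div_le_div_right hτ)

theorem row_le (h τ : ℕ) : S.row n h τ ≤ τ := (rowStart_le _).trans (Nat.div_le_self _ _)

theorem width_le (h : ℕ) : S.width n h ≤ 3 * h := min_le_left _ _

theorem four_pow_mul (h : ℕ) : 4 ^ (3 * h - S.width n h) * 4 ^ S.width n h = 64 ^ h := by
  rw [← pow_add, Nat.sub_add_cancel (S.width_le n h), pow_mul]
  norm_num

theorem capacity_mul_toll {h y : ℕ} (hy : y < 8 ^ S.width n h) :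
    S.capacity n h (rowStart y) * S.toll n h (rowStart y) =
      S.minCapacity n h * (4 ^ (3 * h - S.width n h) * 2 ^ S.width n h) := by
  have hlog : Nat.log 8 y ≤ S.width n h := natLog_le_of_lt_pow (by norm_num) hy
  rw [capacity, toll, if_pos ((rowStart_le y).trans_lt hy), log_rowStart,
    if_pos (pow_log_dvd_rowStart y), ← pow_mul_pow_sub 2 hlog]
  ring

theorem totalToll_mono (h : ℕ) : Monotone (S.totalToll n h) := fun _ _ hy =>
  Finset.sum_le_sum_of_subset (Finset.Ioc_subset_Ioc_right hy)

theorem sum_Ioc_toll_add_totalToll (h : ℕ) {y z : ℕ} (hyz : y ≤ z) :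
    ∑ l ∈ Finset.Ioc y z, S.toll n h l + S.totalToll n h y = S.totalToll n h z := by
  rw [add_comm]
  exact Finset.sum_Ioc_consecutive _ (Nat.zero_le y) hyz

theorem totalToll_eq_add_sum_Ico (h : ℕ) {y z : ℕ} (hy : 0 < y) (hyz : y ≤ z) :
    S.totalToll n h (z - 1) = S.totalToll n h (y - 1) + ∑ l ∈ Finset.Ico y z, S.toll n h l := by
  have hIoc : Finset.Ico y z = Finset.Ioc (y - 1) (z - 1) := by
    ext l
    simp only [Finset.mem_Ico, Finset.mem_Ioc]
    lia
  rw [hIoc, add_comm, S.sum_Ioc_toll_add_totalToll n h (Nat.sub_le_sub_right hyz 1)]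

theorem sum_toll_octave_le {h i : ℕ} (hi : i ≤ S.width n h) :
    ∑ z ∈ Finset.Ico (8 ^ i) (8 ^ (i + 1)), S.toll n h z ≤
      7 * (4 ^ (3 * h - S.width n h) * 2 ^ S.width n h) * 2 ^ i := by
  have htoll : ∀ z ∈ Finset.Ico (8 ^ i) (8 ^ (i + 1)), S.toll n h z =
      if 2 ^ i ∣ z then 4 ^ (3 * h - S.width n h) * 2 ^ (S.width n h - i) else 0 := by
    intro z hz
    rw [Finset.mem_Ico] at hz
    rw [toll, Nat.log_eq_of_pow_le_of_lt_pow hz.1 hz.2]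
  have hcard : #{z ∈ Finset.Ico (8 ^ i) (8 ^ (i + 1)) | 2 ^ i ∣ z} ≤ 7 * 4 ^ i := by
    have h8 : (8 : ℕ) ^ i = 4 ^ i * 2 ^ i := by rw [← mul_pow]; norm_num
    calc _ ≤ 8 * 4 ^ i - 4 ^ i := by
          rw [pow_succ', h8, ← mul_assoc]
          exact card_filter_dvd_Ico_mul_le _ _ (by positivity)
      _ = 7 * 4 ^ i := by lia
  rw [Finset.sum_congr rfl htoll, ← Finset.sum_filter, Finset.sum_const, smul_eq_mul]
  refine (Nat.mul_le_mul_right _ hcard).trans_eq ?_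
  rw [← pow_mul_pow_sub 2 hi, four_pow_eq_sq]
  ring

theorem totalToll_pow_le {h i : ℕ} (hi : i ≤ S.width n h) :
    S.totalToll n h (8 ^ i - 1) ≤ 7 * (4 ^ (3 * h - S.width n h) * 2 ^ S.width n h) * 2 ^ i := by
  induction i with
  | zero => simp [totalToll]
  | succ i ih =>
    have hprev := ih (Nat.le_of_succ_le hi)
    have hoctave := S.sum_toll_octave_le n (Nat.le_of_succ_le hi)
    rw [S.totalToll_eq_add_sum_Ico n h (by positivity)
      (Nat.pow_le_pow_right (by norm_num) i.le_succ), pow_succ 2, ← mul_assoc]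
    lia

theorem totalToll_le {h y : ℕ} (hy : y < 8 ^ S.width n h) : S.totalToll n h y ≤ 7 * 64 ^ h :=
  calc S.totalToll n h y ≤ S.totalToll n h (8 ^ S.width n h - 1) :=
        S.totalToll_mono n h (Nat.le_sub_one_of_lt hy)
    _ ≤ 7 * (4 ^ (3 * h - S.width n h) * 2 ^ S.width n h) * 2 ^ S.width n h :=
        S.totalToll_pow_le n le_rfl
    _ = 7 * 64 ^ h := by
        rw [← S.four_pow_mul n h, four_pow_eq_sq (S.width n h)]
        ring

theorem countP_level_select_le (T h : ℕ) (l : List Counter) :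
    (S.select n T l).countP (fun y => y.level = h) ≤
      2 * S.capacity n h (T / S.slotLength n h) := by
  have hpart {p : Counter → Bool}
      (hp : ∀ y z, p y → p z → (z.row = S.row n h T ↔ y.row = S.row n h T)) :
      ((S.select n T l).filter fun y => y.level = h).countP p ≤
        S.capacity n h (T / S.slotLength n h) := by
    rw [select, List.countP_filter, List.countP_filter]
    refine countP_le_of_forall_countP_le (f := S.rank n)
      (r := fun y z => decide (S.Beats n T y z)) ?_ ?_
    · simp only [Bool.and_eq_true, decide_eq_true_eq]
      rintro y z ⟨⟨hy, rfl⟩, -⟩ ⟨⟨hz, hlevel⟩, -⟩ hrank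
      exact ⟨hlevel, hp y z hy hz, hrank⟩
    · simp only [Bool.and_eq_true, decide_eq_true_eq]
      rintro y ⟨⟨-, rfl⟩, hkeep⟩
      exact hkeep
  rw [List.countP_eq_length_filter,
    List.length_eq_countP_add_countP (fun y => decide (y.row = S.row n h T)), two_mul]
  refine add_le_add (hpart ?_) (hpart ?_) <;> grind

theorem capacity_slot_le (T h : ℕ) :
    S.capacity n h (T / S.slotLength n h) ≤
      S.capacityScale * 2 ^ (S.base n * (2 * S.k - 5)) *
        ((if 3 * h ≤ S.base n then 8 ^ h else 0) +
          if T / (S.slotScale * 2 ^ (S.base n * (2 * S.k - 5))) / 64 ^ h < 8 ^ S.base n then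
            2 ^ Nat.log 8 (T / (S.slotScale * 2 ^ (S.base n * (2 * S.k - 5))) / 64 ^ h)
          else 0) := by
  rcases Nat.lt_or_ge (S.base n) (3 * h) with hh | hh
  · have hwidth : S.width n h = S.base n := min_eq_right hh.le
    have hslot : T / S.slotLength n h =
        T / (S.slotScale * 2 ^ (S.base n * (2 * S.k - 5))) / 64 ^ h := by
      rw [slotLength, hwidth, Nat.div_div_eq_div_mul, mul_right_comm]
    rw [capacity, minCapacity, hwidth, hslot, if_neg (not_le.2 hh), zero_add, mul_ite, mul_zero]
  · have hwidth : S.width n h = 3 * h := min_eq_left hh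
    rw [if_pos hh, capacity, minCapacity, hwidth]
    by_cases hactive : T / S.slotLength n h < 8 ^ (3 * h)
    · rw [if_pos hactive]
      refine Nat.mul_le_mul (by gcongr; norm_num) (le_add_right ?_)
      rw [show (8 : ℕ) ^ h = 2 ^ (3 * h) by rw [pow_mul]; norm_num]
      exact Nat.pow_le_pow_right (by norm_num) (natLog_le_of_lt_pow (by norm_num) hactive)
    · rw [if_neg hactive]
      exact Nat.zero_le _

theorem sum_capacity_le (hk : 3 ≤ S.k) (T : ℕ) :
    ∑ h ∈ Finset.range (S.top n + 1), S.capacity n h (T / S.slotLength n h) ≤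
      S.capacityScale * (S.a * S.k + 5) * 2 ^ (S.base n * (2 * S.k - 4)) := by
  have hearly := sum_eight_pow_ite_le (S.top n + 1) (S.base n)
  have hlate := sum_two_pow_log_div_ite_le
    (T / (S.slotScale * 2 ^ (S.base n * (2 * S.k - 5)))) (S.top n + 1) (S.base n)
  have htop : S.top n ≤ S.a * S.k * 2 ^ S.base n :=
    Nat.mul_le_mul_left _ Nat.lt_two_pow_self.le
  have hone : 1 ≤ 2 ^ S.base n := Nat.one_le_two_pow
  refine (Finset.sum_le_sum fun h _ => S.capacity_slot_le n T h).trans ?_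
  rw [← Finset.mul_sum, Finset.sum_add_distrib]
  calc _ ≤ S.capacityScale * 2 ^ (S.base n * (2 * S.k - 5)) *
          ((S.a * S.k + 5) * 2 ^ S.base n) := by
        refine Nat.mul_le_mul_left _ ?_
        rw [add_mul]
        lia
    _ = _ := by
        rw [show 2 * S.k - 4 = 2 * S.k - 5 + 1 by lia, mul_add_one (S.base n), pow_add 2]
        ring

theorem exists_eq_counter {x ω : ℕ → ℕ} {T : ℕ} {y : Counter} (hy : y ∈ (S.state n x ω T).2) :
    ∃ u < T, ∃ h ≤ S.top n, y = S.counter n x T u h :=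
  S.mem_allCounters n ((S.state_sublist n x ω T).subset hy)

theorem length_state_le (hk : 3 ≤ S.k) (x ω : ℕ → ℕ) (T : ℕ) :
    (S.state n x ω T).2.length ≤
      2 * (S.capacityScale * (S.a * S.k + 5) * 2 ^ (S.base n * (2 * S.k - 4))) := by
  rcases T with - | T
  · exact Nat.zero_le _
  · have hlevel : ∀ y ∈ (S.state n x ω (T + 1)).2, y.level ∈ Finset.range (S.top n + 1) := by
      intro y hy
      obtain ⟨u, -, h, hh, rfl⟩ := S.exists_eq_counter n hy
      exact Finset.mem_range_succ_iff.2 hh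
    calc (S.state n x ω (T + 1)).2.length
        ≤ ∑ h ∈ Finset.range (S.top n + 1), 2 * S.capacity n h (T / S.slotLength n h) := by
          rw [length_eq_sum_countP hlevel, state_succ_snd]
          exact Finset.sum_le_sum fun h _ => S.countP_level_select_le n T h _
      _ ≤ _ := by
          rw [← Finset.mul_sum]
          exact Nat.mul_le_mul_left _ (S.sum_capacity_le n hk T)

theorem lt_pow_base (hk : S.k ≠ 0) : n < 4 ^ (S.k * S.base n) := by
  rw [pow_mul]
  exact Nat.lt_pow_succ_log_self (Nat.one_lt_pow hk (by norm_num)) n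

/-- A number of bits that is enough for the time and for every field of a counter. -/
def fieldBits : ℕ := 2 * S.k * (S.a + 1) * S.base n + 1

theorem lt_two_pow_fieldBits {e N : ℕ} (he : e ≤ S.a + 1) (hN : N ≤ 4 ^ (S.k * S.base n * e)) :
    N < 2 ^ S.fieldBits n := by
  refine hN.trans_lt ?_
  rw [show 4 = 2 ^ 2 by norm_num, ← pow_mul]
  refine Nat.pow_lt_pow_right (by norm_num) (Nat.lt_succ_of_le ?_)
  calc 2 * (S.k * S.base n * e) ≤ 2 * (S.k * S.base n * (S.a + 1)) := by gcongr
    _ = 2 * S.k * (S.a + 1) * S.base n := by ring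

theorem lt_two_pow_fieldBits_of_le_pow (hk : S.k ≠ 0) {e N : ℕ} (he : e ≤ S.a + 1)
    (hN : N ≤ n ^ e) : N < 2 ^ S.fieldBits n := by
  refine S.lt_two_pow_fieldBits n he (hN.trans ?_)
  rw [pow_mul]
  exact Nat.pow_le_pow_left (S.lt_pow_base n hk).le e

theorem encode_counter_lt (hk : S.k ≠ 0) {x : ℕ → ℕ} {T u h : ℕ} (hT : T ≤ n ^ S.a) (hu : u < T)
    (hxu : x u ≤ n) (hh : h ≤ S.top n) :
    Encodable.encode (S.counter n x T u h) < 2 ^ (8 * S.fieldBits n) := by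
  set B := S.fieldBits n
  have htime : T < 2 ^ B := S.lt_two_pow_fieldBits_of_le_pow n hk S.a.le_succ hT
  have hlevel : h < 2 ^ B := by
    refine S.lt_two_pow_fieldBits n S.a.le_succ ?_
    calc h ≤ S.top n := hh
      _ = S.k * S.base n * S.a := by rw [top]; ring
      _ ≤ _ := (Nat.lt_pow_self (by norm_num)).le
  have helement : x u < 2 ^ B :=
    S.lt_two_pow_fieldBits_of_le_pow n hk (e := 1) (by lia) (by rwa [pow_one])
  have hcount : occ x u T < 2 ^ B := (occ_le x u T).trans_lt htime
  have hrow : S.row n h u < 2 ^ B := (S.row_le n h u).trans_lt (hu.trans htime)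
  rw [Counter.encode_eq, show 8 * B = 2 * (2 * (2 * B)) by ring]
  refine natPair_lt_two_pow (hlevel.trans_le ?_) (natPair_lt_two_pow (helement.trans_le ?_)
    (natPair_lt_two_pow hcount hrow)) <;>
  exact Nat.pow_le_pow_right (by norm_num) (by lia)

theorem log_le_of_mem_code (hk : S.k ≠ 0) {x ω : ℕ → ℕ} {T c : ℕ} (hx : ∀ t < T, x t ≤ n)
    (hT : T ≤ n ^ S.a)
    (hc : c ∈ (S.state n x ω T).1 :: (S.state n x ω T).2.map Encodable.encode) :
    Nat.log 2 c ≤ 8 * S.fieldBits n := by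
  refine natLog_le_of_lt_pow one_lt_two ?_
  rcases List.mem_cons.1 hc with rfl | hc
  · rw [state_fst]
    exact (S.lt_two_pow_fieldBits_of_le_pow n hk S.a.le_succ hT).trans_le
      (Nat.pow_le_pow_right (by norm_num) (by lia))
  · obtain ⟨y, hy, rfl⟩ := List.mem_map.1 hc
    obtain ⟨u, hu, h, hh, rfl⟩ := S.exists_eq_counter n hy
    exact S.encode_counter_lt n hk hT hu (hx u hu) hh

theorem length_toBits_le (hk : 3 ≤ S.k) {x : ℕ → ℕ} (ω : ℕ → ℕ) {T : ℕ} (hx : ∀ t < T, x t ≤ n)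
    (hT : T ≤ n ^ S.a) :
    (SamplerState.toBits (S.state n x ω T)).length ≤
      (2 * S.capacityScale * (S.a * S.k + 5) + 1) * 2 ^ (S.base n * (2 * S.k - 4)) *
        ((32 * S.k * (S.a + 1) + 19) * S.base n) := by
  refine (SelfDelimiting.length_encode_le fun c hc =>
    S.log_le_of_mem_code n (by lia) hx hT hc).trans ?_
  rw [List.length_cons, List.length_map]
  refine Nat.mul_le_mul ?_ ?_
  · calc _ ≤ 2 * (S.capacityScale * (S.a * S.k + 5) * 2 ^ (S.base n * (2 * S.k - 4))) +
          2 ^ (S.base n * (2 * S.k - 4)) :=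
          add_le_add (S.length_state_le n hk x ω T) Nat.one_le_two_pow
      _ = _ := by ring
  · have hbase : 1 ≤ S.base n := Nat.le_add_left 1 _
    calc 2 * (8 * S.fieldBits n) + 3 = 32 * S.k * (S.a + 1) * S.base n + 19 := by
          rw [fieldBits]
          ring
      _ ≤ _ := by
          rw [add_mul]
          lia

end Sampler

/-! ### Good arrivals and their rivals -/

theorem card_filter_card_ge_le {α : Type*} [LinearOrder α] (I : Finset α) (M : ℕ) :
    #{u ∈ I | #{w ∈ I | u ≤ w} ≤ M} ≤ M := by
  set last := {u ∈ I | #{w ∈ I | u ≤ w} ≤ M}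
  rcases last.eq_empty_or_nonempty with hempty | hne
  · simp [hempty]
  · refine le_trans (Finset.card_le_card fun u hu => ?_)
      (Finset.mem_filter.1 (last.min'_mem hne)).2
    exact Finset.mem_filter.2 ⟨(Finset.mem_filter.1 hu).1, last.min'_le u hu⟩

theorem min_card_le_card_filter_card_lt_le {α : Type*} [LinearOrder α] (I : Finset α) (r : ℕ) :
    min #I (r + 1) ≤ #{u ∈ I | #{w ∈ I | w < u} ≤ r} := by
  set late := {u ∈ I | r < #{w ∈ I | w < u}}
  rcases late.eq_empty_or_nonempty with hempty | hne
  · rw [Finset.filter_true_of_mem fun u hu => not_lt.1 (Finset.filter_eq_empty_iff.1 hempty hu)]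
    exact min_le_left _ _
  · have hfirst : late.min' hne ∈ late := late.min'_mem hne
    refine (min_le_right _ _).trans
      ((Finset.mem_filter.1 hfirst).2.trans_le (Finset.card_le_card fun w hw => ?_))
    rw [Finset.mem_filter] at hw ⊢
    refine ⟨hw.1, not_lt.1 fun hlate => ?_⟩
    exact (late.min'_le w (Finset.mem_filter.2 ⟨hw.1, hlate⟩)).not_gt hw.2

/-- A discrete rising sun lemma. -/
theorem card_filter_exists_card_Icc_lt_le (I : Finset ℕ) {g : ℕ → ℕ} (hg : Monotone g) {m G : ℕ}
    (hG : ∀ t < m, g t ≤ G) :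
    #{u ∈ I | ∃ T ∈ Finset.Ico u m, #{w ∈ I | w ∈ Finset.Icc u T} + g u < g T} ≤ G := by
  set shaded := {u ∈ I | ∃ T ∈ Finset.Ico u m, #{w ∈ I | w ∈ Finset.Icc u T} + g u < g T}
  suffices htail : ∀ d a, m - a = d → #{u ∈ shaded | a ≤ u} ≤ G - g a by
    simpa using (htail m 0 rfl).trans (Nat.sub_le G (g 0))
  intro d
  induction d using Nat.strong_induction_on with
  | _ d ih =>
    intro a hd
    rcases Nat.lt_or_ge a m with ham | hma
    · by_cases ha : a ∈ shaded
      · obtain ⟨T, hT, hgrowth⟩ := (Finset.mem_filter.1 ha).2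
        rw [Finset.mem_Ico] at hT
        have hsplit : {u ∈ shaded | a ≤ u} ⊆
            {w ∈ I | w ∈ Finset.Icc a T} ∪ {u ∈ shaded | T + 1 ≤ u} := by
          intro u hu
          have huI := Finset.mem_filter.1 (Finset.mem_filter.1 hu).1
          grind
        have hcard := (Finset.card_le_card hsplit).trans (Finset.card_union_le _ _)
        have htail := ih (m - (T + 1)) (by lia) (T + 1) rfl
        have hstep := hg T.le_succ
        have hbound := hG T hT.2
        lia
      · have hskip : {u ∈ shaded | a ≤ u} = {u ∈ shaded | a + 1 ≤ u} :=
          Finset.filter_congr fun u hu =>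
            ⟨fun hau => lt_of_le_of_ne hau fun hne => ha (hne ▸ hu), fun hau => by lia⟩
        have htail := ih (m - (a + 1)) (by lia) (a + 1) rfl
        have hstep := hg a.le_succ
        rw [hskip]
        lia
    · rw [Finset.card_eq_zero.2]
      · exact Nat.zero_le _
      · refine Finset.filter_eq_empty_iff.2 fun u hu hau => ?_
        obtain ⟨T, hT, -⟩ := (Finset.mem_filter.1 hu).2
        rw [Finset.mem_Ico] at hT
        lia

/-- The times before `m` at which `i` arrives. -/
def times (x : ℕ → ℕ) (m i : ℕ) : Finset ℕ := {w ∈ Finset.range m | x w = i}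

theorem mem_times {x : ℕ → ℕ} {m i u : ℕ} : u ∈ times x m i ↔ u < m ∧ x u = i := by
  rw [times, Finset.mem_filter, Finset.mem_range]

theorem card_times (x : ℕ → ℕ) (m i : ℕ) : #(times x m i) = freq x m i := rfl

theorem times_subset_range (x : ℕ → ℕ) (m i : ℕ) : times x m i ⊆ Finset.range m :=
  Finset.filter_subset _ _

theorem occ_add_card_filter_lt {x : ℕ → ℕ} {m u : ℕ} :
    occ x u m + #{w ∈ times x m (x u) | w < u} = freq x m (x u) := by
  rw [← card_times, ← Finset.card_filter_add_card_filter_not (s := times x m (x u))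
    (fun w => u ≤ w)]
  simp only [occ, times, Finset.filter_filter, not_le]
  congr 2
  ext w
  simp only [Finset.mem_filter, Finset.mem_Ico, Finset.mem_range]
  tauto

namespace Sampler

variable (S : Sampler) (n : ℕ)

/-- The total toll of level `h` up to the row of time `τ`. -/
def rowToll (h τ : ℕ) : ℕ := S.totalToll n h (S.row n h τ)

/-- At time `u` an arrival is good if from then on the element keeps arriving at twice the rate of
the tolls of level `h`. -/
def IsGood (x : ℕ → ℕ) (m h u : ℕ) : Prop :=
  ∀ T ∈ Finset.Ico u m, 2 * S.rowToll n h T ≤ occ x u (T + 1) + 2 * S.rowToll n h u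

instance (x : ℕ → ℕ) (m h : ℕ) : DecidablePred (S.IsGood n x m h) :=
  fun _ => inferInstanceAs (Decidable (∀ _ ∈ _, _))

/-- The number of arrivals of `x u` since `u` and before the row `l` of level `h`. -/
def occBeforeRow (x : ℕ → ℕ) (m h l u : ℕ) : ℕ :=
  #{w ∈ times x m (x u) | u ≤ w ∧ S.row n h w < l}

/-- The arrivals of other elements in the row of `u`. -/
def youngRivals (x : ℕ → ℕ) (m h u : ℕ) : Finset ℕ :=
  {v ∈ Finset.range m | x v ≠ x u ∧ S.row n h v = S.row n h u}

/-- The arrivals of other elements before the row `l` whose counters may be better in this row than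
the one that was born at the good time `u`. -/
def oldRivals (x : ℕ → ℕ) (m h l u : ℕ) : Finset ℕ :=
  {v ∈ Finset.range m | x v ≠ x u ∧ S.row n h v < l ∧
    S.totalToll n h l ≤ S.rowToll n h v + freq x m (x v) ∧
    S.occBeforeRow n x m h l u ≤ 2 * freq x m (x v)}

/-- The good times among the first `1 / e` of the arrivals of `i`. -/
def goodTimes (x : ℕ → ℕ) (m h i e : ℕ) : Finset ℕ :=
  {u ∈ times x m i | S.IsGood n x m h u ∧ #{w ∈ times x m i | w < u} ≤ freq x m i / e}

variable {S n}

theorem rowToll_mono (h : ℕ) : Monotone (S.rowToll n h) :=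
  fun _ _ hτ => S.totalToll_mono n h (S.row_mono n h hτ)

theorem slot_lt {m h t : ℕ} (hm : m ≤ S.slotLength n h * 8 ^ S.width n h) (ht : t < m) :
    t / S.slotLength n h < 8 ^ S.width n h :=
  Nat.div_lt_of_lt_mul (ht.trans_le hm)

theorem rowToll_le {m h t : ℕ} (hm : m ≤ S.slotLength n h * 8 ^ S.width n h) (ht : t < m) :
    S.rowToll n h t ≤ 7 * 64 ^ h :=
  S.totalToll_le n ((rowStart_le _).trans_lt (slot_lt hm ht))

theorem capacity_row {m h t : ℕ} (hm : m ≤ S.slotLength n h * 8 ^ S.width n h) (ht : t < m) :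
    S.capacity n h (S.row n h t) = S.minCapacity n h * 2 ^ Nat.log 8 (t / S.slotLength n h) := by
  rw [row, capacity, if_pos ((rowStart_le _).trans_lt (slot_lt hm ht)), log_rowStart]

theorem capacity_slot {m h t : ℕ} (hm : m ≤ S.slotLength n h * 8 ^ S.width n h) (ht : t < m) :
    S.capacity n h (t / S.slotLength n h) = S.capacity n h (S.row n h t) := by
  rw [capacity_row hm ht, capacity, if_pos (slot_lt hm ht)]

theorem minCapacity_le_capacity_row {m h t : ℕ} (hm : m ≤ S.slotLength n h * 8 ^ S.width n h)
    (ht : t < m) : S.minCapacity n h ≤ S.capacity n h (S.row n h t) := by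
  rw [capacity_row hm ht]
  exact Nat.le_mul_of_pos_right _ (by positivity)

theorem minCapacity_pos (hC : 0 < S.capacityScale) (h : ℕ) : 0 < S.minCapacity n h := by
  rw [minCapacity]
  positivity

theorem card_not_isGood_le (x : ℕ → ℕ) {m h : ℕ} (i : ℕ)
    (hm : m ≤ S.slotLength n h * 8 ^ S.width n h) :
    #{u ∈ times x m i | ¬ S.IsGood n x m h u} ≤ 14 * 64 ^ h := by
  have hmono : Monotone fun t => 2 * S.rowToll n h t :=
    fun _ _ ht => Nat.mul_le_mul_left 2 (rowToll_mono h ht)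
  refine le_trans (Finset.card_le_card fun u hu => ?_)
    (card_filter_exists_card_Icc_lt_le (times x m i) hmono (m := m) fun t ht => ?_)
  · rw [Finset.mem_filter] at hu ⊢
    obtain ⟨hu, hbad⟩ := hu
    simp only [IsGood, not_forall, not_le] at hbad
    obtain ⟨T, hT, hbad⟩ := hbad
    refine ⟨hu, T, hT, lt_of_le_of_lt (Nat.add_le_add_right (Finset.card_le_card fun w hw => ?_) _)
      hbad⟩
    simp only [Finset.mem_filter, mem_times, Finset.mem_Icc, Finset.mem_Ico] at hu hw ⊢
    exact ⟨⟨hw.2.1, Nat.lt_succ_iff.2 hw.2.2⟩, hw.1.2.trans hu.2.symm⟩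
  · have := rowToll_le hm ht
    lia

theorem freq_le_mul_card_goodTimes (x : ℕ → ℕ) {m h : ℕ} (i : ℕ) {e : ℕ} (he : 1 ≤ e)
    (hm : m ≤ S.slotLength n h * 8 ^ S.width n h) :
    freq x m i ≤ e * (#(S.goodTimes n x m h i e) + 14 * 64 ^ h) := by
  have hfirst := min_card_le_card_filter_card_lt_le (times x m i) (freq x m i / e)
  have hbad := card_not_isGood_le x i hm
  have hsplit : {u ∈ times x m i | #{w ∈ times x m i | w < u} ≤ freq x m i / e} ⊆
      S.goodTimes n x m h i e ∪ {u ∈ times x m i | ¬ S.IsGood n x m h u} := by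
    intro u hu
    simp only [goodTimes, Finset.mem_union, Finset.mem_filter] at hu ⊢
    tauto
  have hcard := (Finset.card_le_card hsplit).trans (Finset.card_union_le _ _)
  have hmin : min (freq x m i) (freq x m i / e + 1) ≤
      #(S.goodTimes n x m h i e) + 14 * 64 ^ h := by
    rw [card_times] at hfirst
    lia
  refine le_trans ?_ (Nat.mul_le_mul_left e hmin)
  rw [← Nat.mul_min_mul_left]
  exact le_min (Nat.le_mul_of_pos_left _ he) (Nat.lt_mul_div_succ _ he).le

theorem mem_youngRivals_of_beats {x : ℕ → ℕ} {m h u v T : ℕ} (hvm : v < m) (hne : x v ≠ x u)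
    (hrow : S.row n h u = S.row n h T)
    (hbeats : S.Beats n T (S.counter n x (T + 1) u h) (S.counter n x (T + 1) v h)) :
    v ∈ S.youngRivals n x m h u :=
  Finset.mem_filter.2 ⟨Finset.mem_range.2 hvm, hne, (hbeats.2.1.2 hrow).trans hrow.symm⟩

theorem occBeforeRow_le_occ (x : ℕ → ℕ) (m h u T : ℕ) :
    S.occBeforeRow n x m h (S.row n h T) u ≤ occ x u (T + 1) := by
  refine Finset.card_le_card fun w hw => ?_
  simp only [mem_times, Finset.mem_filter, Finset.mem_Ico] at hw ⊢
  obtain ⟨⟨-, hxw⟩, huw, hrow⟩ := hw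
  refine ⟨⟨huw, Nat.lt_succ_of_lt ?_⟩, hxw⟩
  exact lt_of_not_ge fun hTw => hrow.not_ge (S.row_mono n h hTw)

theorem mem_oldRivals_of_beats {x : ℕ → ℕ} {m h u v T : ℕ} (hgood : S.IsGood n x m h u)
    (hT : T ∈ Finset.Ico u m) (hvT : v ≤ T) (hne : x v ≠ x u) (hrow : S.row n h u < S.row n h T)
    (hbeats : S.Beats n T (S.counter n x (T + 1) u h) (S.counter n x (T + 1) v h)) :
    v ∈ S.oldRivals n x m h (S.row n h T) u := by
  obtain ⟨-, hyoung, hrank⟩ := hbeats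
  have hTm : T < m := (Finset.mem_Ico.1 hT).2
  have hrowv : S.row n h v < S.row n h T :=
    lt_of_le_of_ne (S.row_mono n h hvT) fun hv => hrow.ne (hyoung.1 hv)
  change occ x u (T + 1) + S.rowToll n h u ≤ occ x v (T + 1) + S.rowToll n h v at hrank
  have hocc : occ x v (T + 1) ≤ freq x m (x v) :=
    (occ_le_freq x v (T + 1)).trans (freq_mono x (x v) hTm)
  have htoll : S.rowToll n h v ≤ S.rowToll n h T := rowToll_mono h hvT
  have hgoodT := hgood T hT
  have hbefore := S.occBeforeRow_le_occ (n := n) x m h u T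
  refine Finset.mem_filter.2 ⟨Finset.mem_range.2 (hvT.trans_lt hTm), hne, hrowv, ?_, by lia⟩
  change S.rowToll n h T ≤ _
  lia

theorem counter_mem_state_of_isGood {x ω : ℕ → ℕ} {m h u : ℕ} (hh : h ≤ S.top n)
    (hm : m ≤ S.slotLength n h * 8 ^ S.width n h) (hu : u < m) (hω : 64 ^ h ∣ ω u)
    (hgood : S.IsGood n x m h u)
    (hown : 2 * #{v ∈ times x m (x u) | 64 ^ h ∣ ω v} ≤ S.minCapacity n h)
    (hyoung : 2 * #{v ∈ S.youngRivals n x m h u | 64 ^ h ∣ ω v} ≤ S.capacity n h (S.row n h u))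
    (hold : ∀ T < m, S.row n h u < S.row n h T →
      2 * #{v ∈ S.oldRivals n x m h (S.row n h T) u | 64 ^ h ∣ ω v} ≤
        S.capacity n h (S.row n h T)) :
    S.counter n x m u h ∈ (S.state n x ω m).2 := by
  refine S.counter_mem_state n x hh hω hu fun T huT hTm => ?_
  have hmin := minCapacity_le_capacity_row hm hTm
  obtain ⟨V, hcard, hrivals⟩ : ∃ V : Finset ℕ,
      2 * #{v ∈ V | 64 ^ h ∣ ω v} ≤ S.capacity n h (S.row n h T) ∧
      ∀ v ≤ T, x v ≠ x u →
        S.Beats n T (S.counter n x (T + 1) u h) (S.counter n x (T + 1) v h) → v ∈ V := by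
    rcases (S.row_mono n h huT).eq_or_lt with hrow | hrow
    · exact ⟨_, hrow ▸ hyoung, fun v hvT hne hbeats =>
        mem_youngRivals_of_beats (hvT.trans_lt hTm) hne hrow hbeats⟩
    · exact ⟨_, hold T hTm hrow, fun v hvT hne hbeats =>
        mem_oldRivals_of_beats hgood (Finset.mem_Ico.2 ⟨huT, hTm⟩) hvT hne hrow hbeats⟩
  have hsplit : {v ∈ hits ω h (T + 1) | S.Beats n T (S.counter n x (T + 1) u h)
      (S.counter n x (T + 1) v h)} ⊆
      {v ∈ times x m (x u) | 64 ^ h ∣ ω v} ∪ {v ∈ V | 64 ^ h ∣ ω v} := by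
    intro v hv
    simp only [hits, Finset.mem_filter, Finset.mem_range, Finset.mem_union, mem_times] at hv ⊢
    have hvT : v ≤ T := Nat.lt_succ_iff.1 hv.1.1
    by_cases hxv : x v = x u
    · exact Or.inl ⟨⟨hvT.trans_lt hTm, hxv⟩, hv.1.2⟩
    · exact Or.inr ⟨hrivals v hvT hxv hv.2, hv.1.2⟩
  have hunion := (Finset.card_le_card hsplit).trans (Finset.card_union_le _ _)
  rw [capacity_slot hm hTm]
  lia

theorem counter_mem_state_of_le (x ω : ℕ → ℕ) {m u : ℕ} (hu : u < m) (hK : m ≤ S.slotScale)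
    (hC : m ≤ S.capacityScale) : S.counter n x m u 0 ∈ (S.state n x ω m).2 := by
  refine S.counter_mem_state n x (Nat.zero_le _) (one_dvd _) hu fun T _ hT => ?_
  have hwidth : S.width n 0 = 0 := Nat.min_eq_left (Nat.zero_le _)
  have hslot : T / S.slotLength n 0 = 0 := by
    rw [slotLength, hwidth]
    exact Nat.div_eq_of_lt (by simpa using hT.trans_le hK)
  have hcapacity : S.capacity n 0 0 = S.capacityScale := by simp [capacity, minCapacity, hwidth]
  rw [hslot, hcapacity]
  calc _ ≤ #(Finset.range (T + 1)) :=
        (Finset.card_filter_le _ _).trans (Finset.card_filter_le _ _)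
    _ ≤ S.capacityScale := (Finset.card_range _).trans_le (Nat.succ_le_of_lt (hT.trans_le hC))

theorem card_youngRivals_le (hK : 0 < S.slotScale) (x : ℕ → ℕ) {m h u : ℕ}
    (hm : m ≤ S.slotLength n h * 8 ^ S.width n h) (hu : u < m) :
    S.capacityScale * #(S.youngRivals n x m h u) ≤
      S.slotScale * 64 ^ h * S.capacity n h (S.row n h u) := by
  set t := S.slotLength n h with ht
  have htpos : 0 < t := by
    rw [ht, slotLength]
    positivity
  have hsub : S.youngRivals n x m h u ⊆
      Finset.Ico (rowStart (u / t) * t) ((rowStart (u / t) + 2 ^ Nat.log 8 (u / t)) * t) := by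
    intro v hv
    have hrow : rowStart (v / t) = rowStart (u / t) := (Finset.mem_filter.1 hv).2.2
    have hlt := lt_rowStart_add (v / t)
    rw [← log_rowStart (v / t), hrow, log_rowStart] at hlt
    exact Finset.mem_Ico.2 ⟨(Nat.le_div_iff_mul_le htpos).1 (hrow ▸ rowStart_le _),
      (Nat.div_lt_iff_lt_mul htpos).1 hlt⟩
  have hcard : #(S.youngRivals n x m h u) ≤ 2 ^ Nat.log 8 (u / t) * t := by
    refine (Finset.card_le_card hsub).trans_eq ?_
    rw [Nat.card_Ico, add_mul, Nat.add_sub_cancel_left]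
  refine (Nat.mul_le_mul_left _ hcard).trans_eq ?_
  rw [capacity_row hm hu, minCapacity, ht, slotLength]
  ring

theorem card_occBeforeRow_le (x : ℕ → ℕ) (m h i l M : ℕ) :
    #{u ∈ times x m i | S.row n h u < l ∧ S.occBeforeRow n x m h l u ≤ M} ≤ M := by
  refine le_trans (Finset.card_le_card fun u hu => ?_)
    (card_filter_card_ge_le {u ∈ times x m i | S.row n h u < l} M)
  obtain ⟨hu, hrow, hocc⟩ := Finset.mem_filter.1 hu
  refine Finset.mem_filter.2 ⟨Finset.mem_filter.2 ⟨hu, hrow⟩, le_trans (le_of_eq ?_) hocc⟩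
  rw [occBeforeRow, (mem_times.1 hu).2, Finset.filter_filter]
  simp only [and_comm]

/-- The rows of level `h` in which something arrives. -/
def rows (S : Sampler) (n m h : ℕ) : Finset ℕ := (Finset.range m).image (S.row n h)

theorem sum_toll_rows_le (m h v F : ℕ) :
    ∑ l ∈ S.rows n m h with S.row n h v < l ∧ S.totalToll n h l ≤ S.rowToll n h v + F,
      S.toll n h l ≤ F := by
  set A := {l ∈ S.rows n m h | S.row n h v < l ∧ S.totalToll n h l ≤ S.rowToll n h v + F}
  rcases A.eq_empty_or_nonempty with hempty | hne
  · simp [hempty]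
  · obtain ⟨hlast, htotal⟩ := (Finset.mem_filter.1 (A.max'_mem hne)).2
    have hsub : A ⊆ Finset.Ioc (S.row n h v) (A.max' hne) := fun l hl =>
      Finset.mem_Ioc.2 ⟨(Finset.mem_filter.1 hl).2.1, A.le_max' l hl⟩
    have hsum := Finset.sum_le_sum_of_subset (f := S.toll n h) hsub
    have htoll := S.sum_Ioc_toll_add_totalToll n h hlast.le
    rw [rowToll] at htotal
    lia

theorem sum_card_oldRivals_le (x : ℕ → ℕ) (m h i l : ℕ) :
    ∑ u ∈ times x m i with S.row n h u < l, #(S.oldRivals n x m h l u) ≤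
      ∑ v ∈ Finset.range m with x v ≠ i, if S.row n h v < l ∧
        S.totalToll n h l ≤ S.rowToll n h v + freq x m (x v) then 2 * freq x m (x v) else 0 := by
  have hcard : ∀ u ∈ {u ∈ times x m i | S.row n h u < l}, #(S.oldRivals n x m h l u) =
      ∑ v ∈ Finset.range m with x v ≠ i, if (S.row n h v < l ∧
        S.totalToll n h l ≤ S.rowToll n h v + freq x m (x v)) ∧
          S.occBeforeRow n x m h l u ≤ 2 * freq x m (x v) then 1 else 0 := by
    intro u hu
    rw [← Finset.card_filter, oldRivals, Finset.filter_filter,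
      (mem_times.1 (Finset.mem_filter.1 hu).1).2]
    simp only [and_assoc]
  rw [Finset.sum_congr rfl hcard, Finset.sum_comm]
  refine Finset.sum_le_sum fun v _ => ?_
  split_ifs with hv
  · simp only [hv, and_self, true_and]
    rw [← Finset.card_filter, Finset.filter_filter]
    exact card_occBeforeRow_le x m h i l _
  · simp [hv]

theorem sum_toll_mul_card_oldRivals_le (x : ℕ → ℕ) (m h i : ℕ) :
    ∑ l ∈ S.rows n m h, S.toll n h l *
      ∑ u ∈ times x m i with S.row n h u < l, #(S.oldRivals n x m h l u) ≤
    2 * ∑ v ∈ Finset.range m with x v ≠ i, freq x m (x v) ^ 2 := by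
  refine (Finset.sum_le_sum fun l _ =>
    Nat.mul_le_mul_left _ (sum_card_oldRivals_le x m h i l)).trans ?_
  simp only [Finset.mul_sum, mul_ite, mul_zero]
  rw [Finset.sum_comm]
  refine Finset.sum_le_sum fun v _ => ?_
  rw [← Finset.sum_filter, ← Finset.sum_mul]
  calc _ ≤ freq x m (x v) * (2 * freq x m (x v)) :=
        Nat.mul_le_mul_right _ (sum_toll_rows_le m h v _)
    _ = _ := by ring

end Sampler

/-! ### Divisibility of independent random numbers -/

theorem mul_measureReal_le_sum {Ω ι : Type*} [MeasurableSpace Ω] (μ : Measure Ω)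
    [IsFiniteMeasure μ] (V : Finset ι) {B : ι → Set Ω} (hB : ∀ v ∈ V, MeasurableSet (B v))
    [∀ ω, DecidablePred (ω ∈ B ·)] (c : ℝ) :
    c * μ.real {ω | c ≤ #{v ∈ V | ω ∈ B v}} ≤ ∑ v ∈ V, μ.real (B v) := by
  classical
  have hcount : ∀ ω, (#{v ∈ V | ω ∈ B v} : ℝ) = ∑ v ∈ V, (B v).indicator (1 : Ω → ℝ) ω :=
    fun ω => by simp [Set.indicator_apply]
  have hintegrable : ∀ v ∈ V, Integrable ((B v).indicator (1 : Ω → ℝ)) μ := fun v hv =>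
    (integrable_const (1 : ℝ)).indicator (hB v hv)
  calc _ = c * μ.real {ω | c ≤ ∑ v ∈ V, (B v).indicator (1 : Ω → ℝ) ω} := by simp only [hcount]
    _ ≤ ∫ ω, ∑ v ∈ V, (B v).indicator (1 : Ω → ℝ) ω ∂μ :=
        mul_meas_ge_le_integral_of_nonneg (ae_of_all _ fun ω => Finset.sum_nonneg fun v _ =>
          Set.indicator_nonneg (fun _ _ => zero_le_one) ω) (integrable_finsetSum V hintegrable) c
    _ = ∑ v ∈ V, μ.real (B v) := by
        rw [integral_finsetSum V hintegrable]
        exact Finset.sum_congr rfl fun v hv => integral_indicator_one (hB v hv)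

theorem two_thirds_le_toOuterMeasure_map {Ω β : Type*} [MeasurableSpace Ω]
    [DiscreteMeasurableSpace Ω] (p : PMF Ω) (g : Ω → β) {s : Set β}
    (hs : p.toMeasure.real {ω | g ω ∉ s} ≤ 1 / 3) : 2 / 3 ≤ (p.map g).toOuterMeasure s := by
  have hcompl := probReal_add_probReal_compl (μ := p.toMeasure) (s := g ⁻¹' s) .of_discrete
  have hreal : (2 / 3 : ℝ) ≤ p.toMeasure.real (g ⁻¹' s) := by
    change p.toMeasure.real (g ⁻¹' s)ᶜ ≤ 1 / 3 at hs
    linarith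
  rw [PMF.toOuterMeasure_map_apply, ← PMF.toMeasure_apply_eq_toOuterMeasure_apply p .of_discrete]
  calc (2 / 3 : ENNReal) = ENNReal.ofReal (2 / 3) := by
        rw [ENNReal.ofReal_div_of_pos three_pos, ENNReal.ofReal_ofNat, ENNReal.ofReal_ofNat]
    _ ≤ p.toMeasure (g ⁻¹' s) := ENNReal.ofReal_le_of_le_toReal hreal

theorem one_sub_pow_le {p : ℝ} (h0 : 0 ≤ p) (h1 : p ≤ 1) (N : ℕ) :
    (1 - p) ^ N ≤ 1 / (1 + p * N) := by
  rw [le_div_iff₀ (by positivity)]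
  calc (1 - p) ^ N * (1 + p * N) ≤ (1 - p) ^ N * (1 + p) ^ N := by
        rw [mul_comm p]
        exact mul_le_mul_of_nonneg_left (one_add_mul_le_pow (by linarith) N)
          (pow_nonneg (by linarith) _)
    _ = (1 - p ^ 2) ^ N := by rw [← mul_pow]; ring
    _ ≤ 1 := pow_le_one₀ (by nlinarith) (by nlinarith)

/-- The law of `m` independent uniform random numbers below `N`. -/
noncomputable def uniformLaw (m N : ℕ) [NeZero N] : Measure (Fin m → Fin N) :=
  (PMF.uniformOfFintype (Fin m → Fin N)).toMeasure

instance (m N : ℕ) [NeZero N] : IsProbabilityMeasure (uniformLaw m N) :=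
  PMF.toMeasure.isProbabilityMeasure _

theorem uniformLaw_real_forall_mem {m N : ℕ} [NeZero N] {A : Finset ℕ} (hA : A ⊆ Finset.range m)
    (q : ℕ → Prop) [DecidablePred q] :
    (uniformLaw m N).real {ω | ∀ t ∈ A, q (zeroExtend ω t)} =
      ((#{c ∈ Finset.range N | q c} : ℝ) / N) ^ #A := by
  classical
  have hset : {ω : Fin m → Fin N | ∀ t ∈ A, q (zeroExtend ω t)} =
      Fintype.piFinset fun t : Fin m => ({c | (t : ℕ) ∈ A → q c} : Finset (Fin N)) := by
    ext ω
    simp only [Set.mem_ofPred_eq, Finset.mem_coe, Fintype.mem_piFinset, Finset.mem_filter_univ]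
    refine ⟨fun h t ht => by simpa [zeroExtend] using h t ht, fun h t ht => ?_⟩
    simpa [zeroExtend, Finset.mem_range.1 (hA ht)] using h ⟨t, Finset.mem_range.1 (hA ht)⟩ ht
  have hcard : ∀ t : Fin m, (#{c : Fin N | (t : ℕ) ∈ A → q c} : ℝ) / N =
      if (t : ℕ) ∈ A then (#{c ∈ Finset.range N | q c} : ℝ) / N else 1 := fun t => by
    have hN : (N : ℝ) ≠ 0 := Nat.cast_ne_zero.2 (NeZero.ne N)
    split_ifs with ht
    · simp only [ht, true_imp_iff, Finset.card_filter,
        Fin.sum_univ_eq_sum_range fun c => if q c then 1 else 0]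
    · simp [ht, hN]
  calc _ = ∏ t : Fin m, (#{c : Fin N | (t : ℕ) ∈ A → q c} : ℝ) / N := by
        rw [hset, uniformLaw, measureReal_def, PMF.toMeasure_uniformOfFintype_apply _ .of_discrete]
        rw [Finset.prod_div_distrib, Fintype.card_of_finset' _ fun _ => Iff.rfl,
          Fintype.card_piFinset]
        simp
    _ = ∏ t ∈ Finset.range m, if t ∈ A then (#{c ∈ Finset.range N | q c} : ℝ) / N else 1 := by
        rw [Finset.prod_congr rfl fun t _ => hcard t, Fin.prod_univ_eq_prod_range fun t =>
          if t ∈ A then (#{c ∈ Finset.range N | q c} : ℝ) / N else 1]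
    _ = _ := by
        rw [Finset.prod_ite_mem, Finset.prod_const, Finset.inter_eq_right.2 hA]

/-- The event that all random numbers in `A` and more than `c / 2` of those in `V` are divisible
by `d`: more than half of the places are taken by the rivals `V`. -/
def crowded {m N : ℕ} (d : ℕ) (A V : Finset ℕ) (c : ℕ) : Set (Fin m → Fin N) :=
  {ω | (∀ t ∈ A, d ∣ zeroExtend ω t) ∧ c < 2 * #{v ∈ V | d ∣ zeroExtend ω v}}

section Divisibility

variable {m N d : ℕ} [NeZero N]

theorem card_range_filter_dvd_div (hd : d ∣ N) :
    (#{c ∈ Finset.range N | d ∣ c} : ℝ) / N = (d : ℝ)⁻¹ := by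
  obtain ⟨q, rfl⟩ := hd
  have hq : q ≠ 0 := right_ne_zero_of_mul (NeZero.ne (d * q))
  have hd : 0 < d := Nat.pos_of_ne_zero (left_ne_zero_of_mul (NeZero.ne (d * q)))
  have hcard : #{c ∈ Finset.range (d * q) | d ∣ c} = q := by
    simp_rw [← Nat.modEq_zero_iff_dvd]
    rw [← Nat.count_eq_card_filter_range, Nat.count_modEq_card _ hd]
    simp [hd]
  rw [hcard]
  push_cast
  field_simp

theorem uniformLaw_real_forall_dvd (hd : d ∣ N) {A : Finset ℕ} (hA : A ⊆ Finset.range m) :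
    (uniformLaw m N).real {ω | ∀ t ∈ A, d ∣ zeroExtend ω t} = (d : ℝ)⁻¹ ^ #A := by
  rw [uniformLaw_real_forall_mem hA, card_range_filter_dvd_div hd]

theorem uniformLaw_real_forall_not_dvd_le (hd : d ∣ N) {A : Finset ℕ} (hA : A ⊆ Finset.range m) :
    (uniformLaw m N).real {ω | ∀ t ∈ A, ¬ d ∣ zeroExtend ω t} ≤ 1 / (1 + (d : ℝ)⁻¹ * #A) := by
  have hN : (N : ℝ) ≠ 0 := Nat.cast_ne_zero.2 (NeZero.ne N)
  have hcount : (#{c ∈ Finset.range N | ¬ d ∣ c} : ℝ) / N = 1 - (d : ℝ)⁻¹ := by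
    have hsum := Finset.card_filter_add_card_filter_not (s := Finset.range N) (d ∣ ·)
    rw [Finset.card_range] at hsum
    rw [← card_range_filter_dvd_div hd, eq_sub_iff_add_eq', ← add_div, div_eq_one_iff_eq hN]
    exact_mod_cast hsum
  rw [uniformLaw_real_forall_mem hA (¬ d ∣ ·), hcount]
  exact one_sub_pow_le (by positivity) (Nat.cast_inv_le_one d) _

theorem uniformLaw_real_crowded_le (hd : d ∣ N) {A V : Finset ℕ} (hA : A ⊆ Finset.range m)
    (hV : V ⊆ Finset.range m) (hAV : Disjoint A V) {c : ℕ} (hc : 0 < c) :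
    (uniformLaw m N).real (crowded d A V c) ≤ 2 / c * #V * (d : ℝ)⁻¹ ^ (#A + 1) := by
  classical
  set B : ℕ → Set (Fin m → Fin N) := fun v => {ω | ∀ t ∈ insert v A, d ∣ zeroExtend ω t} with hB
  have hcount : ∀ v ∈ V, (uniformLaw m N).real (B v) = (d : ℝ)⁻¹ ^ (#A + 1) := fun v hv => by
    rw [uniformLaw_real_forall_dvd hd (Finset.insert_subset (hV hv) hA),
      Finset.card_insert_of_notMem (Finset.disjoint_right.1 hAV hv)]
  have hmarkov := mul_measureReal_le_sum (uniformLaw m N) V (B := B)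
    (fun v _ => MeasurableSet.of_discrete) (c / 2)
  rw [Finset.sum_congr rfl hcount, Finset.sum_const, nsmul_eq_mul] at hmarkov
  have hsub : crowded d A V c ⊆ {ω | (c / 2 : ℝ) ≤ #{v ∈ V | ω ∈ B v}} := by
    rintro ω ⟨hAω, hcω⟩
    have hfilter : {v ∈ V | d ∣ zeroExtend ω v} = {v ∈ V | ω ∈ B v} := by
      refine Finset.filter_congr fun v _ => ?_
      simpa [hB] using fun _ => hAω
    rw [hfilter] at hcω
    rw [Set.mem_ofPred_eq, div_le_iff₀' two_pos]
    exact_mod_cast hcω.le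
  calc _ ≤ 2 / (c : ℝ) *
          (c / 2 * (uniformLaw m N).real {ω | (c / 2 : ℝ) ≤ #{v ∈ V | ω ∈ B v}}) := by
        rw [← mul_assoc, div_mul_div_cancel₀ (by positivity), div_self two_ne_zero, one_mul]
        exact measureReal_mono hsub
    _ ≤ 2 / c * (#V * (d : ℝ)⁻¹ ^ (#A + 1)) := by gcongr
    _ = _ := by ring

end Divisibility

/-! ### Probability of failure -/

namespace Sampler

variable {S : Sampler} {n : ℕ}

theorem maxRandom_add_one (S : Sampler) (n : ℕ) : S.maxRandom n + 1 = 64 ^ S.top n :=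
  Nat.sub_add_cancel (Nat.one_le_pow _ _ (by norm_num))

theorem pow_dvd_maxRandom_add_one {h : ℕ} (hh : h ≤ S.top n) : 64 ^ h ∣ S.maxRandom n + 1 :=
  S.maxRandom_add_one n ▸ pow_dvd_pow 64 hh

/-- The event that the sampler loses every counter of level `h` born at one of the good times
of `i`. -/
def failure (S : Sampler) (n : ℕ) (x : ℕ → ℕ) (m h i e : ℕ) : Set (S.Randoms n m) :=
  {ω | ∀ u ∈ S.goodTimes n x m h i e,
    S.counter n x m u h ∉ (S.state n x (zeroExtend ω) m).2}

theorem failure_subset (x : ℕ → ℕ) {m h i e : ℕ} (hh : h ≤ S.top n)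
    (hm : m ≤ S.slotLength n h * 8 ^ S.width n h) :
    S.failure n x m h i e ⊆
      {ω | ∀ u ∈ S.goodTimes n x m h i e, ¬ 64 ^ h ∣ zeroExtend ω u} ∪
      crowded (64 ^ h) ∅ (times x m i) (S.minCapacity n h) ∪
      (⋃ u ∈ times x m i,
        crowded (64 ^ h) {u} (S.youngRivals n x m h u) (S.capacity n h (S.row n h u))) ∪
      ⋃ l ∈ S.rows n m h, ⋃ u ∈ {u ∈ times x m i | S.row n h u < l},
        crowded (64 ^ h) {u} (S.oldRivals n x m h l u) (S.capacity n h l) := by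
  intro ω hω
  by_contra hnot
  simp only [Set.mem_union, Set.mem_iUnion, crowded, Set.mem_ofPred_eq, Finset.mem_filter,
    Finset.mem_singleton, forall_eq, Finset.notMem_empty, false_imp_iff, implies_true, true_and,
    not_or, not_exists, not_and, not_forall, not_not, not_lt, and_imp] at hnot
  obtain ⟨⟨⟨⟨u, hu, hhit⟩, hown⟩, hyoung⟩, hold⟩ := hnot
  obtain ⟨hut, hgood, -⟩ := Finset.mem_filter.1 hu
  obtain ⟨hum, rfl⟩ := mem_times.1 hut
  exact hω u hu (counter_mem_state_of_isGood hh hm hum hhit hgood hown (hyoung u hut hhit)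
    fun T hT hrow => hold _ (Finset.mem_image_of_mem _ (Finset.mem_range.2 hT)) u hut hrow hhit)

theorem uniformLaw_real_own_le (hC : 0 < S.capacityScale) (x : ℕ → ℕ) {m h : ℕ} (i : ℕ)
    (hh : h ≤ S.top n) :
    (uniformLaw m (S.maxRandom n + 1)).real
        (crowded (64 ^ h) ∅ (times x m i) (S.minCapacity n h)) ≤
      2 * freq x m i / (S.capacityScale * 64 ^ h) := by
  have hle : (S.capacityScale : ℝ) ≤ S.minCapacity n h :=
    Nat.cast_le.2 (Nat.le_mul_of_pos_right _ (by positivity))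
  refine (uniformLaw_real_crowded_le (pow_dvd_maxRandom_add_one hh) (Finset.empty_subset _)
    (times_subset_range x m i) (Finset.disjoint_empty_left _) (minCapacity_pos hC h)).trans ?_
  rw [card_times, Finset.card_empty, zero_add, pow_one]
  push_cast
  calc 2 / (S.minCapacity n h : ℝ) * freq x m i * ((64 : ℝ) ^ h)⁻¹ ≤
        2 / S.capacityScale * freq x m i * ((64 : ℝ) ^ h)⁻¹ := by gcongr
    _ = _ := by field_simp

theorem uniformLaw_real_young_le (hC : 0 < S.capacityScale) (hK : 0 < S.slotScale) (x : ℕ → ℕ)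
    {m h u : ℕ} (hh : h ≤ S.top n) (hm : m ≤ S.slotLength n h * 8 ^ S.width n h) (hu : u < m) :
    (uniformLaw m (S.maxRandom n + 1)).real
        (crowded (64 ^ h) {u} (S.youngRivals n x m h u) (S.capacity n h (S.row n h u))) ≤
      2 * S.slotScale / (S.capacityScale * 64 ^ h) := by
  have hcap : 0 < S.capacity n h (S.row n h u) :=
    (minCapacity_pos hC h).trans_le (minCapacity_le_capacity_row hm hu)
  have hcard : (S.capacityScale : ℝ) * #(S.youngRivals n x m h u) ≤
      S.slotScale * 64 ^ h * S.capacity n h (S.row n h u) :=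
    mod_cast card_youngRivals_le hK x hm hu
  have hratio : (#(S.youngRivals n x m h u) : ℝ) / S.capacity n h (S.row n h u) ≤
      S.slotScale * 64 ^ h / S.capacityScale := by
    rw [div_le_div_iff₀ (mod_cast hcap) (mod_cast hC)]
    linarith
  refine (uniformLaw_real_crowded_le (V := S.youngRivals n x m h u)
    (pow_dvd_maxRandom_add_one hh) (by simpa using hu) (Finset.filter_subset _ _)
    (by simp [youngRivals]) hcap).trans ?_
  rw [Finset.card_singleton]
  push_cast
  calc _ = (#(S.youngRivals n x m h u) : ℝ) / S.capacity n h (S.row n h u) *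
        (2 * ((64 : ℝ) ^ h)⁻¹ ^ 2) := by ring
    _ ≤ S.slotScale * 64 ^ h / S.capacityScale * (2 * ((64 : ℝ) ^ h)⁻¹ ^ 2) := by gcongr
    _ = _ := by field_simp

theorem uniformLaw_real_iUnion_young_le (hC : 0 < S.capacityScale) (hK : 0 < S.slotScale)
    (x : ℕ → ℕ) {m h : ℕ} (i : ℕ) (hh : h ≤ S.top n)
    (hm : m ≤ S.slotLength n h * 8 ^ S.width n h) :
    (uniformLaw m (S.maxRandom n + 1)).real (⋃ u ∈ times x m i,
        crowded (64 ^ h) {u} (S.youngRivals n x m h u) (S.capacity n h (S.row n h u))) ≤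
      2 * S.slotScale * freq x m i / (S.capacityScale * 64 ^ h) := by
  refine (measureReal_biUnion_finset_le _ _).trans <| (Finset.sum_le_card_nsmul _ _ _ fun u hu =>
    uniformLaw_real_young_le hC hK x hh hm (mem_times.1 hu).1).trans_eq ?_
  rw [card_times, nsmul_eq_mul]
  ring

/-- The product of the capacity and the toll, which is the same in all rows of level `h`. -/
def tollCapacity (S : Sampler) (n h : ℕ) : ℕ :=
  S.minCapacity n h * (4 ^ (3 * h - S.width n h) * 2 ^ S.width n h)

theorem uniformLaw_real_old_le (hC : 0 < S.capacityScale) (x : ℕ → ℕ) {m h u l : ℕ}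
    (hh : h ≤ S.top n) (hm : m ≤ S.slotLength n h * 8 ^ S.width n h) (hu : u < m)
    (hl : l ∈ S.rows n m h) :
    (uniformLaw m (S.maxRandom n + 1)).real
        (crowded (64 ^ h) {u} (S.oldRivals n x m h l u) (S.capacity n h l)) ≤
      2 / ((64 ^ h) ^ 2 * S.tollCapacity n h) * (S.toll n h l * #(S.oldRivals n x m h l u)) := by
  obtain ⟨T, hT, rfl⟩ := Finset.mem_image.1 hl
  have hTm := Finset.mem_range.1 hT
  have hcap : 0 < S.capacity n h (S.row n h T) :=
    (minCapacity_pos hC h).trans_le (minCapacity_le_capacity_row hm hTm)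
  have hprod : (S.capacity n h (S.row n h T) : ℝ) * S.toll n h (S.row n h T) =
      S.tollCapacity n h := mod_cast S.capacity_mul_toll n (slot_lt hm hTm)
  have hpos : (0 : ℝ) < S.tollCapacity n h :=
    Nat.cast_pos.2 (Nat.mul_pos (minCapacity_pos hC h) (by positivity))
  have hcap_ne : (S.capacity n h (S.row n h T) : ℝ) ≠ 0 := left_ne_zero_of_mul (hprod ▸ hpos.ne')
  have htoll_ne : (S.toll n h (S.row n h T) : ℝ) ≠ 0 := right_ne_zero_of_mul (hprod ▸ hpos.ne')
  refine (uniformLaw_real_crowded_le (V := S.oldRivals n x m h (S.row n h T) u)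
    (pow_dvd_maxRandom_add_one hh) (by simpa using hu) (Finset.filter_subset _ _)
    (by simp [oldRivals]) hcap).trans_eq ?_
  rw [Finset.card_singleton, ← hprod]
  push_cast
  field_simp

theorem uniformLaw_real_iUnion_old_le (hC : 0 < S.capacityScale) (x : ℕ → ℕ) {m h : ℕ} (i : ℕ)
    (hh : h ≤ S.top n) (hm : m ≤ S.slotLength n h * 8 ^ S.width n h) :
    (uniformLaw m (S.maxRandom n + 1)).real
        (⋃ l ∈ S.rows n m h, ⋃ u ∈ {u ∈ times x m i | S.row n h u < l},
          crowded (64 ^ h) {u} (S.oldRivals n x m h l u) (S.capacity n h l)) ≤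
      4 * (∑ v ∈ Finset.range m with x v ≠ i, freq x m (x v) ^ 2 : ℕ) /
        ((64 ^ h) ^ 2 * S.tollCapacity n h) := by
  set c : ℝ := 2 / ((64 ^ h) ^ 2 * S.tollCapacity n h) with hc
  have hrow : ∀ l ∈ S.rows n m h, (uniformLaw m (S.maxRandom n + 1)).real
      (⋃ u ∈ {u ∈ times x m i | S.row n h u < l},
        crowded (64 ^ h) {u} (S.oldRivals n x m h l u) (S.capacity n h l)) ≤
      c * (S.toll n h l * ∑ u ∈ times x m i with S.row n h u < l, #(S.oldRivals n x m h l u) : ℕ) :=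
      fun l hl => by
    push_cast
    rw [Finset.mul_sum, Finset.mul_sum]
    refine (measureReal_biUnion_finset_le _ _).trans (Finset.sum_le_sum fun u hu => ?_)
    exact uniformLaw_real_old_le hC x hh hm (mem_times.1 (Finset.mem_filter.1 hu).1).1 hl
  have hsum := sum_toll_mul_card_oldRivals_le (S := S) (n := n) x m h i
  refine (measureReal_biUnion_finset_le _ _).trans ((Finset.sum_le_sum hrow).trans ?_)
  rw [← Finset.mul_sum, ← Nat.cast_sum]
  calc _ ≤ c * (2 * ∑ v ∈ Finset.range m with x v ≠ i, freq x m (x v) ^ 2 : ℕ) := by gcongr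
    _ = _ := by rw [hc]; push_cast; ring

theorem uniformLaw_real_failure_le (hC : 0 < S.capacityScale) (hK : 0 < S.slotScale) (x : ℕ → ℕ)
    {m h : ℕ} (i e : ℕ) (hh : h ≤ S.top n) (hm : m ≤ S.slotLength n h * 8 ^ S.width n h) :
    (uniformLaw m (S.maxRandom n + 1)).real (S.failure n x m h i e) ≤
      1 / (1 + (64 ^ h : ℝ)⁻¹ * #(S.goodTimes n x m h i e)) +
      2 * freq x m i / (S.capacityScale * 64 ^ h) +
      2 * S.slotScale * freq x m i / (S.capacityScale * 64 ^ h) +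
      4 * (∑ v ∈ Finset.range m with x v ≠ i, freq x m (x v) ^ 2 : ℕ) /
        ((64 ^ h) ^ 2 * S.tollCapacity n h) := by
  have hgood : S.goodTimes n x m h i e ⊆ Finset.range m :=
    (Finset.filter_subset _ _).trans (times_subset_range x m i)
  have hnobirth := uniformLaw_real_forall_not_dvd_le (m := m) (pow_dvd_maxRandom_add_one hh) hgood
  push_cast at hnobirth
  refine (measureReal_mono (failure_subset x hh hm)).trans ?_
  refine (measureReal_union_le _ _).trans
    (add_le_add ?_ (uniformLaw_real_iUnion_old_le hC x i hh hm))
  refine (measureReal_union_le _ _).trans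
    (add_le_add ?_ (uniformLaw_real_iUnion_young_le hC hK x i hh hm))
  exact (measureReal_union_le _ _).trans
    (add_le_add hnobirth (uniformLaw_real_own_le hC x i hh))

end Sampler

/-! ### Frequencies in the presence of a heavy element -/

theorem pow_mul_pow_sub_le_pow_add_pow {R : Type*} [CommSemiring R] [LinearOrder R]
    [IsOrderedRing R] {a b : R} (ha : 0 ≤ a) (hb : 0 ≤ b) {q k : ℕ} (hqk : q ≤ k) :
    a ^ q * b ^ (k - q) ≤ a ^ k + b ^ k := by
  rcases le_total a b with hab | hba
  · calc _ ≤ b ^ q * b ^ (k - q) := by gcongr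
      _ = b ^ k := pow_mul_pow_sub b hqk
      _ ≤ _ := le_add_of_nonneg_left (pow_nonneg ha k)
  · calc _ ≤ a ^ q * a ^ (k - q) := by gcongr
      _ = a ^ k := pow_mul_pow_sub a hqk
      _ ≤ _ := le_add_of_nonneg_right (pow_nonneg hb k)

theorem sum_pow_le_of_sum_pow_le {ι : Type*} {s : Finset ι} {g : ι → ℕ} {k q f N : ℕ}
    (hq : q ≠ 0) (hqk : q ≤ k) (hN : 0 < N) (hf : 0 < f) (hsum : ∑ j ∈ s, g j ^ k ≤ f ^ k)
    (hcard : #{j ∈ s | 0 < g j} ≤ N ^ k) :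
    ∑ j ∈ s, g j ^ q ≤ 2 * N ^ (k - q) * f ^ q := by
  have hterm : ∀ j, N ^ q * f ^ (k - q) * g j ^ q ≤ N ^ k * g j ^ k + f ^ k := fun j => by
    have h := pow_mul_pow_sub_le_pow_add_pow (N * g j).zero_le f.zero_le hqk
    rw [mul_pow, mul_pow] at h
    exact (mul_right_comm _ _ _).trans_le h
  have hsupport : ∑ j ∈ s, g j ^ q = ∑ j ∈ s with 0 < g j, g j ^ q :=
    (Finset.sum_filter_of_ne fun j _ hj => Nat.pos_of_ne_zero (ne_zero_pow hq hj)).symm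
  refine Nat.le_of_mul_le_mul_left ?_ (by positivity : 0 < N ^ q * f ^ (k - q))
  calc N ^ q * f ^ (k - q) * ∑ j ∈ s, g j ^ q
    _ ≤ ∑ j ∈ s with 0 < g j, (N ^ k * g j ^ k + f ^ k) := by
        rw [hsupport, Finset.mul_sum]
        exact Finset.sum_le_sum fun j _ => hterm j
    _ ≤ N ^ k * ∑ j ∈ s, g j ^ k + N ^ k * f ^ k := by
        rw [Finset.sum_add_distrib, ← Finset.mul_sum, Finset.sum_const, smul_eq_mul]
        gcongr
        exact Finset.filter_subset _ _
    _ ≤ N ^ k * f ^ k + N ^ k * f ^ k := by gcongr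
    _ = N ^ q * f ^ (k - q) * (2 * N ^ (k - q) * f ^ q) := by
        rw [← pow_mul_pow_sub N hqk, ← pow_mul_pow_sub f hqk]
        ring

theorem add_div_lt_of_pow_lt {k e f g : ℕ} (he : 2 * k ≤ e) (h : 2 * g ^ k < f ^ k) :
    g + f / e < f := by
  rcases Nat.eq_zero_or_pos k with rfl | hk
  · simp at h
  by_contra! hle
  have he_pos : (0 : ℝ) < e := Nat.cast_pos.2 (by lia)
  have hratio : (k : ℝ) / e ≤ 1 / 2 := by
    rw [div_le_div_iff₀ he_pos two_pos]
    exact_mod_cast (by lia : k * 2 ≤ 1 * e)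
  have hratio' : (1 : ℝ) / e ≤ 1 := (div_le_one he_pos).2 (Nat.one_le_cast.2 (by lia))
  have hbernoulli : (1 / 2 : ℝ) ≤ (1 - 1 / e) ^ k := by
    calc (1 / 2 : ℝ) ≤ 1 + k * -(1 / e) := by rw [mul_neg, mul_one_div]; linarith
      _ ≤ (1 + -(1 / e)) ^ k := one_add_mul_le_pow (by linarith) k
      _ = _ := by rw [← sub_eq_add_neg]
  have hg : (f : ℝ) * (1 - 1 / e) ≤ g := by
    have hle' : (f : ℝ) ≤ g + (f / e : ℕ) := mod_cast hle
    have hdiv : ((f / e : ℕ) : ℝ) ≤ f / e := Nat.cast_div_le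
    rw [mul_one_sub, mul_one_div]
    linarith
  refine lt_irrefl ((f : ℝ) ^ k) ?_
  calc (f : ℝ) ^ k = 2 * (f ^ k * (1 / 2)) := by ring
    _ ≤ 2 * (f ^ k * (1 - 1 / e) ^ k) := by gcongr
    _ = 2 * (f * (1 - 1 / e)) ^ k := by rw [mul_pow]
    _ ≤ 2 * g ^ k := by
        have : 0 ≤ (f : ℝ) * (1 - 1 / e) := mul_nonneg f.cast_nonneg (sub_nonneg.2 hratio')
        gcongr
    _ < f ^ k := mod_cast h

theorem exists_mul_pow_le_lt {b c f : ℕ} (hb : 1 < b) (hc : 0 < c) (hf : c ≤ f) :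
    ∃ h, c * b ^ h ≤ f ∧ f < b * c * b ^ h := by
  refine ⟨Nat.log b (f / c), ?_, ?_⟩
  · rw [mul_comm]
    exact (Nat.le_div_iff_mul_le hc).1 (Nat.pow_log_le_self b (Nat.div_pos hf hc).ne')
  · refine ((Nat.div_lt_iff_lt_mul hc).1 (Nat.lt_pow_succ_log_self hb (f / c))).trans_eq ?_
    rw [Nat.succ_eq_add_one, pow_succ]
    ring

theorem one_sub_mul_le_of_le_add_div {ε : ℝ} {e f g : ℕ} (he : 1 / ε ≤ e) (hε : 0 < ε)
    (hle : f ≤ g + f / e) : (1 - ε) * f ≤ g := by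
  have he_inv : (e : ℝ)⁻¹ ≤ ε := inv_le_of_inv_le₀ hε (by rwa [← one_div])
  have hdiv : ((f / e : ℕ) : ℝ) ≤ ε * f := by
    refine Nat.cast_div_le.trans ?_
    rw [div_eq_mul_inv, mul_comm]
    gcongr
  have hle' : (f : ℝ) ≤ g + (f / e : ℕ) := mod_cast hle
  linarith

theorem frequency_map_range (x : ℕ → ℕ) (m j : ℕ) :
    frequency ((List.range m).map x) j = freq x m j := by
  rw [frequency, List.count, List.countP_map, List.countP_eq_length_filter]
  rfl

theorem isStream_map_range {n : ℕ} {x : ℕ → ℕ} {m : ℕ} :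
    IsStream n ((List.range m).map x) ↔ ∀ t < m, x t ∈ Finset.Icc 1 n := by
  simp only [IsStream, List.mem_map, List.mem_range, forall_exists_index, and_imp,
    forall_apply_eq_imp_iff₂]

theorem exists_eq_map_range (D : List ℕ) : ∃ x : ℕ → ℕ, D = (List.range D.length).map x :=
  ⟨fun t => D.getD t 0, List.ext_getElem (by simp) fun t ht _ => by simp [ht]⟩

theorem sum_filter_ne_eq {n : ℕ} {x : ℕ → ℕ} {m : ℕ} (hx : ∀ t < m, x t ∈ Finset.Icc 1 n)
    (i : ℕ) (F : ℕ → ℕ) :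
    ∑ v ∈ Finset.range m with x v ≠ i, F (x v) =
      ∑ j ∈ (Finset.Icc 1 n).erase i, freq x m j * F j := by
  have hmaps : ∀ v ∈ {v ∈ Finset.range m | x v ≠ i}, x v ∈ (Finset.Icc 1 n).erase i :=
    fun v hv => by
    obtain ⟨hvm, hne⟩ := Finset.mem_filter.1 hv
    exact Finset.mem_erase.2 ⟨hne, hx v (Finset.mem_range.1 hvm)⟩
  rw [← Finset.sum_fiberwise_of_maps_to hmaps]
  refine Finset.sum_congr rfl fun j hj => ?_
  rw [Finset.sum_congr rfl fun v hv => congrArg F (Finset.mem_filter.1 hv).2, Finset.sum_const,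
    smul_eq_mul, Finset.filter_filter]
  congr 2
  refine Finset.filter_congr fun v _ => ⟨And.right, fun hv => ⟨?_, hv⟩⟩
  exact hv ▸ (Finset.mem_erase.1 hj).1

theorem freq_add_sum_freq {n : ℕ} {x : ℕ → ℕ} {m : ℕ} (hx : ∀ t < m, x t ∈ Finset.Icc 1 n)
    (i : ℕ) : freq x m i + ∑ j ∈ (Finset.Icc 1 n).erase i, freq x m j = m := by
  have hothers := sum_filter_ne_eq hx i fun _ => 1
  simp only [mul_one] at hothers
  rw [← hothers, freq, ← Finset.card_eq_sum_ones, Finset.card_filter_add_card_filter_not,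
    Finset.card_range]

namespace IsHeavy

variable {k n : ℕ} {x : ℕ → ℕ} {m i : ℕ}

theorem sum_freq_pow_lt (hi : IsHeavy k n ((List.range m).map x) i) :
    100 * ∑ j ∈ (Finset.Icc 1 n).erase i, freq x m j ^ k < freq x m i ^ k := by
  simpa only [frequency_map_range] using hi.2

theorem sum_freq_pow_le (hi : IsHeavy k n ((List.range m).map x) i) :
    ∑ j ∈ (Finset.Icc 1 n).erase i, freq x m j ^ k ≤ freq x m i ^ k :=
  (Nat.le_mul_of_pos_left _ (by norm_num)).trans hi.sum_freq_pow_lt.le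

theorem freq_pos (hk : k ≠ 0) (hi : IsHeavy k n ((List.range m).map x) i) : 0 < freq x m i :=
  (Nat.pow_pos_iff.1 ((Nat.zero_le _).trans_lt hi.sum_freq_pow_lt)).resolve_right hk

theorem freq_add_div_lt (hi : IsHeavy k n ((List.range m).map x) i) {e : ℕ} (he : 2 * k ≤ e)
    {j : ℕ} (hj : j ∈ (Finset.Icc 1 n).erase i) :
    freq x m j + freq x m i / e < freq x m i := by
  refine add_div_lt_of_pow_lt he ((Nat.mul_le_mul (by norm_num : 2 ≤ 100) ?_).trans_lt
    hi.sum_freq_pow_lt)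
  exact Finset.single_le_sum (f := fun j => freq x m j ^ k) (fun _ _ => Nat.zero_le _) hj

theorem length_le_of_freq_le (hk : k ≠ 0) (hi : IsHeavy k n ((List.range m).map x) i)
    (hx : ∀ t < m, x t ∈ Finset.Icc 1 n) {M : ℕ} (hM : freq x m i ≤ M) : m ≤ 2 * M ^ k := by
  calc m = freq x m i + ∑ j ∈ (Finset.Icc 1 n).erase i, freq x m j := (freq_add_sum_freq hx i).symm
    _ ≤ freq x m i ^ k + ∑ j ∈ (Finset.Icc 1 n).erase i, freq x m j ^ k :=
        add_le_add (Nat.le_self_pow hk _) (Finset.sum_le_sum fun j _ => Nat.le_self_pow hk _)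
    _ ≤ M ^ k + M ^ k := by
        have hpow := Nat.pow_le_pow_left hM k
        exact add_le_add hpow (hi.sum_freq_pow_le.trans hpow)
    _ = _ := (two_mul _).symm

section Sampler

variable {S : Sampler} {h M : ℕ}

theorem card_freq_pos_le (hk : S.k ≠ 0) (hi : IsHeavy S.k n ((List.range m).map x) i)
    (hM : 0 < M) (hf : freq x m i ≤ M * 64 ^ h) :
    #{j ∈ (Finset.Icc 1 n).erase i | 0 < freq x m j} ≤ (M * 4 ^ S.width n h) ^ S.k := by
  rcases le_total (S.base n) (3 * h) with hh | hh
  · calc _ ≤ #(Finset.Icc 1 n) := (Finset.card_filter_le _ _).trans Finset.card_erase_le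
      _ = n := by rw [Nat.card_Icc, Nat.add_sub_cancel]
      _ ≤ (4 ^ S.base n) ^ S.k := by
          rw [← pow_mul, mul_comm]
          exact (S.lt_pow_base n hk).le
      _ ≤ (M * 4 ^ S.base n) ^ S.k := Nat.pow_le_pow_left (Nat.le_mul_of_pos_left _ hM) _
      _ = _ := by rw [Sampler.width, min_eq_right hh]
  · calc _ = ∑ j ∈ (Finset.Icc 1 n).erase i with 0 < freq x m j, 1 := Finset.card_eq_sum_ones _
      _ ≤ ∑ j ∈ (Finset.Icc 1 n).erase i with 0 < freq x m j, freq x m j ^ S.k :=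
          Finset.sum_le_sum fun j hj =>
            Nat.one_le_pow _ _ (Finset.mem_filter.1 hj).2
      _ ≤ ∑ j ∈ (Finset.Icc 1 n).erase i, freq x m j ^ S.k :=
          Finset.sum_le_sum_of_subset (Finset.filter_subset _ _)
      _ ≤ (M * 64 ^ h) ^ S.k := hi.sum_freq_pow_le.trans (Nat.pow_le_pow_left hf _)
      _ = _ := by
          rw [Sampler.width, min_eq_left hh, pow_mul]
          norm_num

theorem sum_freq_pow_le_of_le (hi : IsHeavy S.k n ((List.range m).map x) i) (hM : 0 < M)
    (hf : freq x m i ≤ M * 64 ^ h) {q : ℕ} (hq : q ≠ 0) (hqk : q ≤ S.k) :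
    ∑ j ∈ (Finset.Icc 1 n).erase i, freq x m j ^ q ≤
      2 * (M * 4 ^ S.width n h) ^ (S.k - q) * freq x m i ^ q := by
  have hk : S.k ≠ 0 := by lia
  exact sum_pow_le_of_sum_pow_le hq hqk (Nat.mul_pos hM (by positivity)) (hi.freq_pos hk)
    hi.sum_freq_pow_le (hi.card_freq_pos_le hk hM hf)

theorem length_le_slotLength_mul (hk : 3 ≤ S.k) (hi : IsHeavy S.k n ((List.range m).map x) i)
    (hx : ∀ t < m, x t ∈ Finset.Icc 1 n) (hM : 0 < M) (hK : S.slotScale = 3 * M ^ S.k)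
    (hf : freq x m i ≤ M * 64 ^ h) : m ≤ S.slotLength n h * 8 ^ S.width n h := by
  have hothers := hi.sum_freq_pow_le_of_le hM hf one_ne_zero (by lia)
  simp only [pow_one] at hothers
  have hpos : 0 < (M * 4 ^ S.width n h) ^ (S.k - 1) := by positivity
  calc m = freq x m i + ∑ j ∈ (Finset.Icc 1 n).erase i, freq x m j := (freq_add_sum_freq hx i).symm
    _ ≤ (M * 4 ^ S.width n h) ^ (S.k - 1) * freq x m i +
          2 * (M * 4 ^ S.width n h) ^ (S.k - 1) * freq x m i :=
        add_le_add (Nat.le_mul_of_pos_left _ hpos) hothers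
    _ = 3 * (M * 4 ^ S.width n h) ^ (S.k - 1) * freq x m i := by ring
    _ ≤ 3 * (M * 4 ^ S.width n h) ^ (S.k - 1) * (M * 64 ^ h) := Nat.mul_le_mul_left _ hf
    _ = S.slotLength n h * 8 ^ S.width n h := by
        obtain ⟨j, hj⟩ := Nat.exists_eq_add_of_le' hk
        rw [Sampler.slotLength, hK, hj, show j + 3 - 1 = j + 2 by lia,
          show 2 * (j + 3) - 5 = 2 * j + 1 by lia, show (8 : ℕ) = 4 * 2 by norm_num, mul_pow 4,
          four_pow_eq_sq]
        ring

theorem capacityScale_mul_sum_freq_sq_le (hk : 3 ≤ S.k)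
    (hi : IsHeavy S.k n ((List.range m).map x) i) (hx : ∀ t < m, x t ∈ Finset.Icc 1 n)
    (hM : 0 < M) (hf : freq x m i ≤ M * 64 ^ h) :
    S.capacityScale * ∑ v ∈ Finset.range m with x v ≠ i, freq x m (x v) ^ 2 ≤
      2 * M ^ S.k * ((64 ^ h) ^ 2 * S.tollCapacity n h) := by
  rw [sum_filter_ne_eq hx i fun j => freq x m j ^ 2]
  simp only [← pow_succ']
  calc _ ≤ S.capacityScale * (2 * (M * 4 ^ S.width n h) ^ (S.k - 3) * (M * 64 ^ h) ^ 3) :=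
        Nat.mul_le_mul_left _ ((hi.sum_freq_pow_le_of_le hM hf three_ne_zero hk).trans
          (Nat.mul_le_mul_left _ (Nat.pow_le_pow_left hf 3)))
    _ = _ := by
        obtain ⟨j, hj⟩ := Nat.exists_eq_add_of_le' hk
        rw [Sampler.tollCapacity, Sampler.minCapacity, mul_pow M, mul_pow M, hj, Nat.add_sub_cancel,
          show 2 * (j + 3) - 5 = 2 * j + 1 by lia, ← S.four_pow_mul n h,
          four_pow_eq_sq (S.width n h)]
        ring

theorem best_state_of_counter_mem {e : ℕ} (hk : k ≠ 0) (he : 2 * k ≤ e)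
    (hi : IsHeavy k n ((List.range m).map x) i) (hx : ∀ t < m, x t ∈ Finset.Icc 1 n) {ω : ℕ → ℕ}
    {u : ℕ} (hu : u ∈ times x m i) (hearly : #{w ∈ times x m i | w < u} ≤ freq x m i / e)
    (hmem : S.counter n x m u h ∈ (S.state n x ω m).2) :
    (best (S.state n x ω m).2).1 = i ∧
      freq x m i ≤ (best (S.state n x ω m).2).2 + freq x m i / e := by
  obtain ⟨-, rfl⟩ := mem_times.1 hu
  have hcount : freq x m (x u) ≤ (best (S.state n x ω m).2).2 + freq x m (x u) / e := by
    have hbest : occ x u m ≤ _ := le_best hmem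
    have hocc := occ_add_card_filter_lt (x := x) (m := m) (u := u)
    lia
  refine ⟨?_, hcount⟩
  rcases S.best_state n x ω m with hbest | ⟨v, hv, helement, hle⟩
  · rw [hbest, zero_add] at hcount
    exact absurd hcount (Nat.div_lt_self (hi.freq_pos hk) (by lia)).not_ge
  · by_contra hne
    have hlt := hi.freq_add_div_lt he
      (Finset.mem_erase.2 ⟨hne, helement ▸ hx v hv⟩)
    rw [helement] at hlt
    lia

end Sampler

end IsHeavy

/-! ### Choice of the parameters -/

namespace Sampler

/-- The sampler that finds the heavy elements `i` by the counters of level `h` if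
`f_i ≤ M * 64 ^ h`. -/
def ofScale (k a M : ℕ) : Sampler where
  k := k
  a := a
  slotScale := 3 * M ^ k
  capacityScale := 100 * M * (3 * M ^ k)

variable {n : ℕ} {x : ℕ → ℕ} {m i k a M h : ℕ}

theorem four_mul_sum_freq_sq_div_le (hk : 3 ≤ k) (hi : IsHeavy k n ((List.range m).map x) i)
    (hx : ∀ t < m, x t ∈ Finset.Icc 1 n) (hM : 0 < M) (hf : freq x m i ≤ M * 64 ^ h) :
    4 * (∑ v ∈ Finset.range m with x v ≠ i, freq x m (x v) ^ 2 : ℕ) /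
      ((64 ^ h) ^ 2 * (ofScale k a M).tollCapacity n h) ≤ (1 / 30 : ℝ) := by
  have hscale : 300 * M ^ k ≤ (ofScale k a M).capacityScale := by
    rw [ofScale]
    nlinarith [Nat.one_le_pow k M hM]
  have hsum := hi.capacityScale_mul_sum_freq_sq_le (S := ofScale k a M) hk hx hM hf
  have hpos : 0 < (ofScale k a M).tollCapacity n h :=
    Nat.mul_pos (minCapacity_pos (by rw [ofScale]; positivity) h) (by positivity)
  rw [div_le_div_iff₀ (by positivity) (by norm_num)]
  norm_cast
  refine Nat.le_of_mul_le_mul_left ?_ (by positivity : 0 < 2 * M ^ k)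
  calc _ = 240 * M ^ k * ∑ v ∈ Finset.range m with x v ≠ i, freq x m (x v) ^ 2 := by ring
    _ ≤ 300 * M ^ k * ∑ v ∈ Finset.range m with x v ≠ i, freq x m (x v) ^ 2 := by gcongr; norm_num
    _ ≤ _ := Nat.mul_le_mul_right _ hscale
    _ ≤ _ := hsum
    _ = _ := by rw [one_mul]; rfl

theorem le_card_goodTimes {S : Sampler} (x : ℕ → ℕ) {e : ℕ} (he : 1 ≤ e)
    (hm : m ≤ S.slotLength n h * 8 ^ S.width n h) (hle : 28 * e * 64 ^ h ≤ freq x m i) :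
    14 * 64 ^ h ≤ #(S.goodTimes n x m h i e) := by
  refine Nat.le_of_add_le_add_right (b := 14 * 64 ^ h) (Nat.le_of_mul_le_mul_left ?_ he)
  calc e * (14 * 64 ^ h + 14 * 64 ^ h) = 28 * e * 64 ^ h := by ring
    _ ≤ freq x m i := hle
    _ ≤ _ := freq_le_mul_card_goodTimes x i he hm

theorem uniformLaw_real_failure_le_third (hk : 3 ≤ k)
    (hi : IsHeavy k n ((List.range m).map x) i) (hx : ∀ t < m, x t ∈ Finset.Icc 1 n) {e : ℕ}
    (he : 1 ≤ e) (hh : h ≤ (ofScale k a M).top n) (hle : 28 * e * 64 ^ h ≤ freq x m i)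
    (hf : freq x m i ≤ M * 64 ^ h) :
    (uniformLaw m ((ofScale k a M).maxRandom n + 1)).real ((ofScale k a M).failure n x m h i e) ≤
      1 / 3 := by
  set S := ofScale k a M with hS
  have hM : 0 < M := Nat.pos_of_mul_pos_right ((hi.freq_pos (by lia)).trans_le hf)
  have hK : 0 < S.slotScale := by rw [hS, ofScale]; positivity
  have hC : 0 < S.capacityScale := by rw [hS, ofScale]; positivity
  have hC' : (S.capacityScale : ℝ) = 100 * M * S.slotScale := by rw [hS, ofScale]; push_cast; rfl
  have hf' : (freq x m i : ℝ) ≤ M * 64 ^ h := mod_cast hf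
  have hm : m ≤ S.slotLength n h * 8 ^ S.width n h :=
    hi.length_le_slotLength_mul (S := S) hk hx hM rfl hf
  have hgood : 14 * 64 ^ h ≤ #(S.goodTimes n x m h i e) := le_card_goodTimes x he hm hle
  have hbirth : 1 / (1 + (64 ^ h : ℝ)⁻¹ * #(S.goodTimes n x m h i e)) ≤ 1 / 15 := by
    have hgood' : 14 ≤ (64 ^ h : ℝ)⁻¹ * #(S.goodTimes n x m h i e) := by
      rw [inv_mul_eq_div, le_div_iff₀ (by positivity)]
      exact_mod_cast hgood
    exact one_div_le_one_div_of_le (by norm_num) (by linarith)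
  have hyoung : 2 * S.slotScale * freq x m i / (S.capacityScale * 64 ^ h) ≤ (1 / 50 : ℝ) := by
    rw [hC', div_le_div_iff₀ (by positivity) (by norm_num)]
    calc 2 * S.slotScale * freq x m i * 50 ≤ 2 * S.slotScale * (M * 64 ^ h) * (50 : ℝ) := by gcongr
      _ = _ := by ring
  have hown : 2 * freq x m i / (S.capacityScale * 64 ^ h) ≤ (1 / 50 : ℝ) := by
    refine le_trans ?_ hyoung
    gcongr
    exact le_mul_of_one_le_right zero_le_two (Nat.one_le_cast.2 hK)
  have hold : _ ≤ (1 / 30 : ℝ) := four_mul_sum_freq_sq_div_le (a := a) hk hi hx hM hf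
  linarith [uniformLaw_real_failure_le hC hK x i e hh hm]

theorem le_top_of_le_freq (hk : k ≠ 0) (hm : m ≤ n ^ a) (hh : 64 ^ h ≤ freq x m i) :
    h ≤ (ofScale k a M).top n := by
  refine (Nat.pow_le_pow_iff_right (by norm_num : 1 < 4)).1 ?_
  calc 4 ^ h ≤ 64 ^ h := Nat.pow_le_pow_left (by norm_num) h
    _ ≤ freq x m i := hh
    _ ≤ m := (Finset.card_filter_le _ _).trans_eq (Finset.card_range m)
    _ ≤ n ^ a := hm
    _ ≤ (4 ^ (k * (ofScale k a M).base n)) ^ a :=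
        Nat.pow_le_pow_left ((ofScale k a M).lt_pow_base n hk).le a
    _ = 4 ^ (ofScale k a M).top n := by
        rw [← pow_mul, top]
        congr 1
        exact Nat.mul_comm _ _ |>.trans (Nat.mul_assoc _ _ _).symm

theorem best_state_of_freq_le {e : ℕ} (hk : k ≠ 0) (he : 2 * k ≤ e)
    (hi : IsHeavy k n ((List.range m).map x) i) (hx : ∀ t < m, x t ∈ Finset.Icc 1 n)
    (hM : 0 < M) (hf : freq x m i ≤ M) (ω : ℕ → ℕ) :
    (best ((ofScale k a M).state n x ω m).2).1 = i ∧
      freq x m i ≤ (best ((ofScale k a M).state n x ω m).2).2 + freq x m i / e := by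
  have hne : (times x m i).Nonempty := Finset.card_pos.1 (hi.freq_pos hk)
  have hfirst := (times x m i).min'_mem hne
  have hnone : {w ∈ times x m i | w < (times x m i).min' hne} = ∅ :=
    Finset.filter_eq_empty_iff.2 fun w hw => not_lt.2 ((times x m i).min'_le w hw)
  have hlength : m ≤ (ofScale k a M).slotScale :=
    (hi.length_le_of_freq_le hk hx hf).trans (Nat.mul_le_mul_right _ (by norm_num))
  have hscale : (ofScale k a M).slotScale ≤ (ofScale k a M).capacityScale :=
    Nat.le_mul_of_pos_left _ (by lia)
  exact hi.best_state_of_counter_mem hk he hx hfirst (by rw [hnone]; exact Nat.zero_le _)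
    (counter_mem_state_of_le x ω (mem_times.1 hfirst).1 hlength (hlength.trans hscale))

theorem two_thirds_le_answer {e : ℕ} (hk : 3 ≤ k) (he : 2 * k ≤ e)
    (hi : IsHeavy k n ((List.range m).map x) i) (hx : ∀ t < m, x t ∈ Finset.Icc 1 n)
    (hm : m ≤ n ^ a) :
    2 / 3 ≤ ((ofScale k a (64 * (28 * e))).algorithm.answer n
      ((List.range m).map x)).toOuterMeasure
        {o | o.1 = i ∧ freq x m i ≤ o.2 + freq x m i / e} := by
  have hk₀ : k ≠ 0 := by lia
  rw [algorithm_answer_eq]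
  refine two_thirds_le_toOuterMeasure_map _ _ ?_
  rcases le_or_gt (28 * e) (freq x m i) with hlarge | hsmall
  · obtain ⟨h, hle, hlt⟩ := exists_mul_pow_le_lt (by norm_num : 1 < 64) (by lia) hlarge
    have htop : h ≤ (ofScale k a (64 * (28 * e))).top n :=
      le_top_of_le_freq hk₀ hm ((Nat.le_mul_of_pos_left _ (by lia)).trans hle)
    refine (measureReal_mono fun ω hω => ?_).trans
      (uniformLaw_real_failure_le_third hk hi hx (e := e) (by lia) htop hle hlt.le)
    intro u hu hmem
    obtain ⟨htime, -, hearly⟩ := Finset.mem_filter.1 hu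
    exact hω (hi.best_state_of_counter_mem hk₀ he hx htime hearly hmem)
  · have hsuccess : ∀ ω, _ := best_state_of_freq_le (a := a) hk₀ he hi hx
      (by lia : 0 < 64 * (28 * e)) (by lia)
    simp [hsuccess]

theorem four_pow_mul_base_le (hn : n ≠ 0) (S : Sampler) :
    4 ^ (S.k * S.base n) ≤ 4 ^ S.k * n := by
  rw [pow_mul, base, pow_succ']
  exact Nat.mul_le_mul_left _ (Nat.pow_log_le_self _ hn)

theorem base_le_log {S : Sampler} (hk : S.k ≠ 0) (hn : 2 ≤ n) :
    (S.base n : ℝ) ≤ 3 * Real.log n := by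
  have hlog_two := Real.log_two_gt_d9
  have hlog_n : Real.log 2 ≤ Real.log n := Real.log_le_log two_pos (Nat.ofNat_le_cast.2 hn)
  have hlog_pow : 1 ≤ Real.log (4 ^ S.k : ℕ) := by
    push_cast
    rw [Real.log_pow, show (4 : ℝ) = 2 ^ 2 by norm_num, Real.log_pow]
    have hk' : (1 : ℝ) ≤ S.k := Nat.one_le_cast.2 (Nat.pos_of_ne_zero hk)
    push_cast
    nlinarith
  have hfloor : (Nat.log (4 ^ S.k) n : ℝ) ≤ Real.log n := by
    refine (Real.natLog_le_logb n (4 ^ S.k)).trans ?_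
    exact div_le_self (by linarith) hlog_pow
  rw [base]
  push_cast
  linarith

theorem two_pow_base_mul_le {S : Sampler} (hk : 2 ≤ S.k) (hn : n ≠ 0) :
    (2 : ℝ) ^ (S.base n * (2 * S.k - 4)) ≤ 4 ^ S.k * (n : ℝ) ^ (1 - 2 / (S.k : ℝ)) := by
  have hk' : (2 : ℝ) ≤ S.k := Nat.ofNat_le_cast.2 hk
  have hexp : 0 ≤ 1 - 2 / (S.k : ℝ) := sub_nonneg.2 ((div_le_one (by linarith)).2 hk')
  have hexp' : 1 - 2 / (S.k : ℝ) ≤ 1 := sub_le_self 1 (by positivity)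
  have hbase : (4 : ℝ) ^ (S.k * S.base n) ≤ 4 ^ S.k * n := mod_cast S.four_pow_mul_base_le hn
  calc (2 : ℝ) ^ (S.base n * (2 * S.k - 4)) =
      ((4 : ℝ) ^ (S.k * S.base n)) ^ (1 - 2 / (S.k : ℝ)) := by
        rw [show (4 : ℝ) = 2 ^ 2 by norm_num, ← pow_mul, ← Real.rpow_natCast 2 (2 * _),
          ← Real.rpow_mul zero_le_two, ← Real.rpow_natCast]
        congr 1
        push_cast [Nat.cast_sub (by lia : 4 ≤ 2 * S.k)]
        field_simp
        ring
    _ ≤ (4 ^ S.k * n) ^ (1 - 2 / (S.k : ℝ)) := Real.rpow_le_rpow (by positivity) hbase hexp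
    _ = ((4 : ℝ) ^ S.k) ^ (1 - 2 / (S.k : ℝ)) * (n : ℝ) ^ (1 - 2 / (S.k : ℝ)) :=
        Real.mul_rpow (by positivity) (by positivity)
    _ ≤ 4 ^ S.k * (n : ℝ) ^ (1 - 2 / (S.k : ℝ)) := by
        gcongr
        exact Real.rpow_le_self_of_one_le (one_le_pow₀ (by norm_num)) hexp'

/-- The factor of `n ^ (1 - 2 / k) * log n` in the bound for the space of the sampler. -/
def spaceConstant (S : Sampler) : ℝ :=
  (2 * S.capacityScale * (S.a * S.k + 5) + 1) * 4 ^ S.k * ((32 * S.k * (S.a + 1) + 19) * 3)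

theorem spaceConstant_pos (S : Sampler) : 0 < S.spaceConstant := by
  rw [spaceConstant]
  positivity

theorem length_toBits_le_spaceConstant_mul {S : Sampler} (hk : 3 ≤ S.k) (hn : 2 ≤ n)
    (ω : ℕ → ℕ) (hx : ∀ t < m, x t ≤ n) (hm : m ≤ n ^ S.a) :
    ((SamplerState.toBits (S.state n x ω m)).length : ℝ) ≤
      S.spaceConstant * ((n : ℝ) ^ (1 - 2 / (S.k : ℝ)) * Real.log n) := by
  have hlength : ((SamplerState.toBits (S.state n x ω m)).length : ℝ) ≤
      (2 * S.capacityScale * (S.a * S.k + 5) + 1) * 2 ^ (S.base n * (2 * S.k - 4)) *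
        ((32 * S.k * (S.a + 1) + 19) * S.base n) :=
    mod_cast S.length_toBits_le n hk ω hx hm
  calc _ ≤ (2 * S.capacityScale * (S.a * S.k + 5) + 1) *
          (4 ^ S.k * (n : ℝ) ^ (1 - 2 / (S.k : ℝ))) *
        ((32 * S.k * (S.a + 1) + 19) * (3 * Real.log n)) := by
        refine hlength.trans ?_
        gcongr
        · exact two_pow_base_mul_le (by lia) (by lia)
        · exact base_le_log (by lia) hn
    _ = _ := by rw [spaceConstant]; ring

theorem algorithm_usesAtMostBits {S : Sampler} (hk : 3 ≤ S.k) (hn : 2 ≤ n) {D : List ℕ}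
    (hD : IsStream n D) (hlength : D.length ≤ n ^ S.a) :
    S.algorithm.UsesAtMostBits n D
      (S.spaceConstant * ((n : ℝ) ^ (1 - 2 / (S.k : ℝ)) * Real.log n)) := by
  intro D' hprefix w hw
  have hD' : IsStream n D' := fun p hp => hD p (hprefix.subset hp)
  obtain ⟨x, hx⟩ := exists_eq_map_range D'
  rw [hx, algorithm_run_eq, PMF.support_map] at hw
  obtain ⟨ω, -, rfl⟩ := hw
  rw [hx, isStream_map_range] at hD'
  exact length_toBits_le_spaceConstant_mul hk hn _ (fun t ht => (Finset.mem_Icc.1 (hD' t ht)).2)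
    (hprefix.length_le.trans hlength)

theorem le_frequency_of_mem_support (S : Sampler) (hn : 1 ≤ n) {D : List ℕ}
    (hD : IsStream n D) {o : ℕ × ℕ} (ho : o ∈ (S.algorithm.answer n D).support) :
    o.1 ∈ Finset.Icc 1 n ∧ o.2 ≤ frequency D o.1 := by
  obtain ⟨x, hx⟩ := exists_eq_map_range D
  have hfreq (j : ℕ) : frequency D j = freq x D.length j := by rw [hx, frequency_map_range, ← hx]
  rw [hx, isStream_map_range] at hD
  rw [hx, algorithm_answer_eq, PMF.support_map] at ho
  obtain ⟨ω, -, rfl⟩ := ho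
  beta_reduce
  rcases S.best_state n x (zeroExtend ω) D.length with hbest | ⟨u, hu, helement, hle⟩
  · rw [hbest]
    exact ⟨Finset.mem_Icc.2 ⟨le_rfl, hn⟩, Nat.zero_le _⟩
  · rw [hfreq, helement]
    exact ⟨hD u hu, hle⟩

theorem two_thirds_le_answer_of_isHeavy {ε : ℝ} (hε : 0 < ε) {e : ℕ} (hk : 3 ≤ k)
    (he : max (1 / ε) (2 * k) ≤ e) {D : List ℕ} (hD : IsStream n D) (hlength : D.length ≤ n ^ a)
    (hi : IsHeavy k n D i) :
    2 / 3 ≤ ((ofScale k a (64 * (28 * e))).algorithm.answer n D).toOuterMeasure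
      {o | o.1 = i ∧ (1 - ε) * (frequency D i : ℝ) ≤ (o.2 : ℝ)} := by
  obtain ⟨x, hx⟩ := exists_eq_map_range D
  have hfreq : frequency D i = freq x D.length i := by rw [hx, frequency_map_range, ← hx]
  have hek : 2 * k ≤ e := by exact_mod_cast (le_max_right _ _).trans he
  rw [hx] at hD hi
  have hanswer := two_thirds_le_answer hk hek hi (isStream_map_range.1 hD) hlength
  rw [← hx] at hanswer
  refine hanswer.trans (measure_mono ?_)
  rintro o ⟨helement, hle⟩
  rw [← hfreq] at hle
  exact ⟨helement, one_sub_mul_le_of_le_add_div ((le_max_left _ _).trans he) hε hle⟩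

end Sampler

theorem theorem3 (k : ℕ) (hk : 3 ≤ k) (ε : ℝ) (hε : 0 < ε) (a : ℕ) :
    ∃ A : StreamingAlgorithm, ∃ C : ℝ, 0 < C ∧
      ∀ n : ℕ, 2 ≤ n → ∀ D : List ℕ, IsStream n D → D.length ≤ n ^ a →
        A.UsesAtMostBits n D (C * ((n : ℝ) ^ (1 - 2 / (k : ℝ)) * Real.log n)) ∧
        (∀ o ∈ (A.answer n D).support, o.1 ∈ Finset.Icc 1 n ∧ o.2 ≤ frequency D o.1) ∧
        (∀ i : ℕ, IsHeavy k n D i →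
          2 / 3 ≤ (A.answer n D).toOuterMeasure
            {o | o.1 = i ∧ (1 - ε) * (frequency D i : ℝ) ≤ (o.2 : ℝ)}) := by
  obtain ⟨e, he⟩ := exists_nat_ge (max (1 / ε) (2 * k))
  set S := Sampler.ofScale k a (64 * (28 * e))
  refine ⟨S.algorithm, S.spaceConstant, S.spaceConstant_pos, fun n hn D hD hlength => ⟨?_, ?_, ?_⟩⟩
  · exact Sampler.algorithm_usesAtMostBits hk hn hD hlength
  · exact fun o ho => S.le_frequency_of_mem_support (by lia) hD ho
  · exact fun i hi => Sampler.two_thirds_le_answer_of_isHeavy hε hk he hD hlength hi
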